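/- Consider probabilistic programs over variables $x_0,x_1,x_2,\dots$, generated by the grammar $$P ::= v := e \;\mid\; P;P \;\mid\; \{P\}\,[p]\,\{P\} \;\mid\; \mathtt{WHILE}\,(b)\,\{P\},$$ where $v$ is a variable, $e$ is an arithmetical expression built from variables and nonnegative rational constants by $+,-,\cdot$, $p$ is a rational number in $[0,1]$, and $b$ is a Boolean combination of comparisons ($=$, $<$) of arithmetical expressions. Rational constants and probabilities are written as fractions of natural numbers, and programs are coded by natural numbers through a standard Gödel numbering. An input (valuation) is a map $\eta$ from the variables to the nonnegative rationals. An assignment $v := e$ stores $\max\{\llbracket e\rrbracket_\eta,0\}$ in $v$; $\{P_1\}[p]\{P_2\}$ executes $P_1$ with probability $p$ and $P_2$ with probability $1-p$; sequential composition and loops have their usual meaning. The termination probability is $$\Pr_{P,\eta}({\downarrow})=\sum_{k=0}^{\infty}\ \sum_{w\in\{L,R\}^{\le k}}\alpha_k(P,\eta,w),$$ where $\alpha_k(P,\eta,w)$ is the product of the probabilities of the choices $w$ if $P$ started on $\eta$ terminates after exactly $k$ steps when its probabilistic choices are resolved (left or right) by exactly the word $w$, and $0$ otherwise. Let $\mathrm{UAST}$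 be the set of programs $P$ with $\Pr_{P,\eta}({\downarrow})=1$ for every input $\eta$, and let $\mathrm{AST}$ be the set of pairs $(P,\eta)$ with $\Pr_{P,\eta}({\downarrow})=1$, where $\eta$ ranges over the inputs with finitely many nonzero values, presented as finite lists of fractions. A set $A$ is in $\Pi^0_2$ if $A=\{x \mid \forall y_1\,\exists y_2\colon (x,y_1,y_2)\in R\}$ for some decidable relation $R$, and it is $\Pi^0_2$-complete if it is in $\Pi^0_2$ and every set in $\Pi^0_2$ is many-one reducible to it by a total computable function. **Theorem.** $\mathrm{UAST}$ is $\Pi^0_2$-complete. Moreover, universal almost-sure termination is exactly as hard as almost-sure termination on a given input: $\mathrm{UAST}\le_{\mathrm m}\mathrm{AST}$ and $\mathrm{AST}\le_{\mathrm m}\mathrm{UAST}$. -/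

import Mathlib

namespace PGCL

open scoped NNRat NNReal ENNReal

/-! ### Syntax -/

/-- Program variables `x₀, x₁, x₂, …`. -/
abbrev Var : Type := ℕ

/-- A nonnegative rational written as a fraction: `(n, d)` denotes `n / (d + 1)`. -/
abbrev FracLit : Type := ℕ × ℕ

/-- The rational denoted by a fraction literal. -/
def FracLit.value (q : FracLit) : ℚ≥0 := (q.1 : ℚ≥0) / ((q.2 : ℚ≥0) + 1)

/-- A rational probability in `[0, 1]`, written by its odds: the literal denotes
`left / (left + right)`. -/
@[ext] structure ProbLit where
  left : ℕ
  right : ℕ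
  pos : 0 < left + right

/-- The probability denoted by a probability literal. -/
def ProbLit.value (p : ProbLit) : ℚ≥0 := (p.left : ℚ≥0) / ((p.left : ℚ≥0) + (p.right : ℚ≥0))

/-- Fraction literals denote exactly the nonnegative rationals. -/
theorem FracLit.exists_value_eq (q : ℚ≥0) : ∃ l : FracLit, l.value = q := by
  refine ⟨(q.num, q.den - 1), ?_⟩
  have h := q.den_pos
  have e : ((q.den - 1 : ℕ) : ℚ≥0) + 1 = q.den := by
    have : q.den - 1 + 1 = q.den := by omega
    exact_mod_cast this
  rw [FracLit.value, e, NNRat.num_div_den]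

theorem ProbLit.value_le_one (p : ProbLit) : p.value ≤ 1 := by
  unfold ProbLit.value
  apply div_le_one_of_le₀ <;> simp

/-- Probability literals denote exactly the rationals in `[0, 1]`. -/
theorem ProbLit.exists_value_eq (q : ℚ≥0) (hq : q ≤ 1) : ∃ p : ProbLit, p.value = q := by
  have h := q.den_pos
  have hle : q.num ≤ q.den := by
    rw [← NNRat.num_div_den q, div_le_one (by exact_mod_cast h)] at hq
    exact_mod_cast hq
  refine ⟨⟨q.num, q.den - q.num, by omega⟩, ?_⟩
  have e : (q.num : ℚ≥0) + ((q.den - q.num : ℕ) : ℚ≥0) = q.den := by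
    have : q.num + (q.den - q.num) = q.den := by omega
    exact_mod_cast this
  rw [ProbLit.value, e, NNRat.num_div_den]

/-- Arithmetical expressions over the program variables. -/
inductive AExp : Type
  | lit (q : FracLit)
  | var (v : Var)
  | add (e₁ e₂ : AExp)
  | sub (e₁ e₂ : AExp)
  | mul (e₁ e₂ : AExp)

/-- Boolean expressions over arithmetical expressions. -/
inductive BExp : Type
  | eq (e₁ e₂ : AExp)
  | lt (e₁ e₂ : AExp)
  | not (b : BExp)
  | and (b₁ b₂ : BExp)

/-- Probabilistic programs: `v := e`, `P; Q`, `{P} [p] {Q}` and `WHILE (b) {P}`. -/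
inductive Prog : Type
  | assign (v : Var) (e : AExp)
  | seq (P Q : Prog)
  | choice (p : ProbLit) (P Q : Prog)
  | while (b : BExp) (P : Prog)

/-! ### Gödel numbering of the syntax

Each syntactic category is put in an explicit bijection with `ℕ`; through it, computability of
functions on programs is computability on the natural numbers (in the sense of Mathlib's
`Computable`). -/

/-- `Nat.unpair (n + 1)` runs through all pairs except `(0, 0)`. -/
def ProbLit.equivNat : ProbLit ≃ ℕ where
  toFun p := Nat.pair p.left p.right - 1
  invFun n := ⟨(Nat.unpair (n + 1)).1, (Nat.unpair (n + 1)).2, by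
    by_contra h
    have h1 : (Nat.unpair (n + 1)).1 = 0 := by omega
    have h2 : (Nat.unpair (n + 1)).2 = 0 := by omega
    have h3 := Nat.pair_unpair (n + 1)
    rw [h1, h2] at h3
    have h4 : Nat.pair 0 0 = 0 := rfl
    omega⟩
  left_inv p := by
    have h := Nat.add_le_pair p.left p.right
    have hp := p.pos
    have e : Nat.pair p.left p.right - 1 + 1 = Nat.pair p.left p.right := by omega
    ext <;> simp [e]
  right_inv n := by simp

instance : Denumerable ProbLit := Denumerable.mk' ProbLit.equivNat

namespace AExp

/-- Code of an arithmetical expression. -/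
def code : AExp → ℕ
  | lit q => 5 * Nat.pair q.1 q.2
  | var v => 5 * v + 1
  | add e₁ e₂ => 5 * Nat.pair e₁.code e₂.code + 2
  | sub e₁ e₂ => 5 * Nat.pair e₁.code e₂.code + 3
  | mul e₁ e₂ => 5 * Nat.pair e₁.code e₂.code + 4

/-- The arithmetical expression with a given code. -/
def ofCode (n : ℕ) : AExp :=
  have h₁ : (Nat.unpair (n / 5)).1 ≤ n / 5 := Nat.unpair_left_le _
  have h₂ : (Nat.unpair (n / 5)).2 ≤ n / 5 := Nat.unpair_right_le _
  if h : n % 5 = 0 then lit (Nat.unpair (n / 5))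
  else if n % 5 = 1 then var (n / 5)
  else if n % 5 = 2 then add (ofCode (Nat.unpair (n / 5)).1) (ofCode (Nat.unpair (n / 5)).2)
  else if n % 5 = 3 then sub (ofCode (Nat.unpair (n / 5)).1) (ofCode (Nat.unpair (n / 5)).2)
  else mul (ofCode (Nat.unpair (n / 5)).1) (ofCode (Nat.unpair (n / 5)).2)
termination_by n
decreasing_by all_goals omega

theorem ofCode_code (e : AExp) : ofCode e.code = e := by
  induction e with
  | lit q => rw [code, ofCode]; simp
  | var v =>
    have h1 (m : ℕ) : (5 * m + 1) % 5 = 1 := by omega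
    have h2 (m : ℕ) : (5 * m + 1) / 5 = m := by omega
    rw [code, ofCode]; simp [h1, h2]
  | add a b iha ihb =>
    have h1 : (5 * Nat.pair a.code b.code + 2) % 5 = 2 := by omega
    have h2 : (5 * Nat.pair a.code b.code + 2) / 5 = Nat.pair a.code b.code := by omega
    rw [code, ofCode]; simp [h1, h2, iha, ihb]
  | sub a b iha ihb =>
    have h1 : (5 * Nat.pair a.code b.code + 3) % 5 = 3 := by omega
    have h2 : (5 * Nat.pair a.code b.code + 3) / 5 = Nat.pair a.code b.code := by omega
    rw [code, ofCode]; simp [h1, h2, iha, ihb]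
  | mul a b iha ihb =>
    have h1 : (5 * Nat.pair a.code b.code + 4) % 5 = 4 := by omega
    have h2 : (5 * Nat.pair a.code b.code + 4) / 5 = Nat.pair a.code b.code := by omega
    rw [code, ofCode]; simp [h1, h2, iha, ihb]

theorem code_ofCode (n : ℕ) : (ofCode n).code = n := by
  induction n using Nat.strong_induction_on with
  | _ n ih =>
    have hl := Nat.unpair_left_le (n / 5)
    have hr := Nat.unpair_right_le (n / 5)
    rw [ofCode]
    split_ifs with h0 h1 h2 h3
    · simp only [code, Nat.pair_unpair]; omega
    · simp only [code]; omega
    all_goals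
      simp only [code]
      rw [ih _ (by omega), ih _ (by omega), Nat.pair_unpair]
      omega

instance : Denumerable AExp := Denumerable.mk' ⟨code, ofCode, ofCode_code, code_ofCode⟩

end AExp

namespace BExp

/-- Code of a Boolean expression. -/
def code : BExp → ℕ
  | eq e₁ e₂ => 4 * Nat.pair e₁.code e₂.code
  | lt e₁ e₂ => 4 * Nat.pair e₁.code e₂.code + 1
  | not b => 4 * b.code + 2
  | and b₁ b₂ => 4 * Nat.pair b₁.code b₂.code + 3

/-- The Boolean expression with a given code. -/
def ofCode (n : ℕ) : BExp :=
  have h₁ : (Nat.unpair (n / 4)).1 ≤ n / 4 := Nat.unpair_left_le _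
  have h₂ : (Nat.unpair (n / 4)).2 ≤ n / 4 := Nat.unpair_right_le _
  if h : n % 4 = 0 then eq (.ofCode (Nat.unpair (n / 4)).1) (.ofCode (Nat.unpair (n / 4)).2)
  else if n % 4 = 1 then lt (.ofCode (Nat.unpair (n / 4)).1) (.ofCode (Nat.unpair (n / 4)).2)
  else if n % 4 = 2 then not (ofCode (n / 4))
  else and (ofCode (Nat.unpair (n / 4)).1) (ofCode (Nat.unpair (n / 4)).2)
termination_by n
decreasing_by all_goals omega

theorem ofCode_code (b : BExp) : ofCode b.code = b := by
  induction b with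
  | eq a b => rw [code, ofCode]; simp [AExp.ofCode_code]
  | lt a b =>
    have h1 : (4 * Nat.pair a.code b.code + 1) % 4 = 1 := by omega
    have h2 : (4 * Nat.pair a.code b.code + 1) / 4 = Nat.pair a.code b.code := by omega
    rw [code, ofCode]; simp [h1, h2, AExp.ofCode_code]
  | not a iha =>
    have h1 : (4 * a.code + 2) % 4 = 2 := by omega
    have h2 : (4 * a.code + 2) / 4 = a.code := by omega
    rw [code, ofCode]; simp [h1, h2, iha]
  | and a b iha ihb =>
    have h1 : (4 * Nat.pair a.code b.code + 3) % 4 = 3 := by omega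
    have h2 : (4 * Nat.pair a.code b.code + 3) / 4 = Nat.pair a.code b.code := by omega
    rw [code, ofCode]; simp [h1, h2, iha, ihb]

theorem code_ofCode (n : ℕ) : (ofCode n).code = n := by
  induction n using Nat.strong_induction_on with
  | _ n ih =>
    have hl := Nat.unpair_left_le (n / 4)
    have hr := Nat.unpair_right_le (n / 4)
    rw [ofCode]
    split_ifs with h0 h1 h2
    · simp only [code, AExp.code_ofCode, Nat.pair_unpair]; omega
    · simp only [code, AExp.code_ofCode, Nat.pair_unpair]; omega
    · simp only [code]
      rw [ih _ (by omega)]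
      omega
    · simp only [code]
      rw [ih _ (by omega), ih _ (by omega), Nat.pair_unpair]
      omega

instance : Denumerable BExp := Denumerable.mk' ⟨code, ofCode, ofCode_code, code_ofCode⟩

end BExp

namespace Prog

/-- Code of a program. -/
def code : Prog → ℕ
  | assign v e => 4 * Nat.pair v e.code
  | seq P Q => 4 * Nat.pair P.code Q.code + 1
  | choice p P Q => 4 * Nat.pair (ProbLit.equivNat p) (Nat.pair P.code Q.code) + 2
  | .while b P => 4 * Nat.pair b.code P.code + 3

/-- The program with a given code. -/
def ofCode (n : ℕ) : Prog :=
  have h₁ : (Nat.unpair (n / 4)).1 ≤ n / 4 := Nat.unpair_left_le _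
  have h₂ : (Nat.unpair (n / 4)).2 ≤ n / 4 := Nat.unpair_right_le _
  have h₃ : (Nat.unpair (Nat.unpair (n / 4)).2).1 ≤ n / 4 := (Nat.unpair_left_le _).trans h₂
  have h₄ : (Nat.unpair (Nat.unpair (n / 4)).2).2 ≤ n / 4 := (Nat.unpair_right_le _).trans h₂
  if h : n % 4 = 0 then assign (Nat.unpair (n / 4)).1 (.ofCode (Nat.unpair (n / 4)).2)
  else if n % 4 = 1 then seq (ofCode (Nat.unpair (n / 4)).1) (ofCode (Nat.unpair (n / 4)).2)
  else if n % 4 = 2 then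
    choice (ProbLit.equivNat.symm (Nat.unpair (n / 4)).1)
      (ofCode (Nat.unpair (Nat.unpair (n / 4)).2).1)
      (ofCode (Nat.unpair (Nat.unpair (n / 4)).2).2)
  else .while (.ofCode (Nat.unpair (n / 4)).1) (ofCode (Nat.unpair (n / 4)).2)
termination_by n
decreasing_by all_goals omega

theorem ofCode_code (P : Prog) : ofCode P.code = P := by
  induction P with
  | assign v e => rw [code, ofCode]; simp [AExp.ofCode_code]
  | seq P Q ihP ihQ =>
    have h1 : (4 * Nat.pair P.code Q.code + 1) % 4 = 1 := by omega
    have h2 : (4 * Nat.pair P.code Q.code + 1) / 4 = Nat.pair P.code Q.code := by omega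
    rw [code, ofCode]; simp [h1, h2, ihP, ihQ]
  | choice p P Q ihP ihQ =>
    have h1 (m : ℕ) : (4 * m + 2) % 4 = 2 := by omega
    have h2 (m : ℕ) : (4 * m + 2) / 4 = m := by omega
    rw [code, ofCode]; simp [h1, h2, ihP, ihQ]
  | _ b P ihP =>
    have h1 (m : ℕ) : (4 * m + 3) % 4 = 3 := by omega
    have h2 (m : ℕ) : (4 * m + 3) / 4 = m := by omega
    rw [code, ofCode]; simp [h1, h2, ihP, BExp.ofCode_code]

theorem code_ofCode (n : ℕ) : (ofCode n).code = n := by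
  induction n using Nat.strong_induction_on with
  | _ n ih =>
    have hl := Nat.unpair_left_le (n / 4)
    have hr := Nat.unpair_right_le (n / 4)
    have hrl := Nat.unpair_left_le (Nat.unpair (n / 4)).2
    have hrr := Nat.unpair_right_le (Nat.unpair (n / 4)).2
    rw [ofCode]
    split_ifs with h0 h1 h2
    · simp only [code, AExp.code_ofCode, Nat.pair_unpair]; omega
    · simp only [code]
      rw [ih _ (by omega), ih _ (by omega), Nat.pair_unpair]
      omega
    · simp only [code]
      rw [ih _ (by omega), ih _ (by omega), Nat.pair_unpair, Equiv.apply_symm_apply,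
        Nat.pair_unpair]
      omega
    · simp only [code, BExp.code_ofCode]
      rw [ih _ (by omega), Nat.pair_unpair]
      omega

instance : Denumerable Prog := Denumerable.mk' ⟨code, ofCode, ofCode_code, code_ofCode⟩

end Prog

/-! ### Semantics -/

/-- Variable valuations; these are also the program inputs. -/
abbrev Val : Type := Var → ℚ≥0

/-- Evaluation of arithmetical expressions. Intermediate values may be negative. -/
def AExp.eval (η : Val) : AExp → ℚ
  | .lit q => q.value
  | .var v => η v
  | .add e₁ e₂ => e₁.eval η + e₂.eval η
  | .sub e₁ e₂ => e₁.eval η - e₂.eval η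
  | .mul e₁ e₂ => e₁.eval η * e₂.eval η

/-- Evaluation of Boolean expressions. -/
def BExp.eval (η : Val) : BExp → Bool
  | .eq e₁ e₂ => decide (e₁.eval η = e₂.eval η)
  | .lt e₁ e₂ => decide (e₁.eval η < e₂.eval η)
  | .not b => !b.eval η
  | .and b₁ b₂ => b₁.eval η && b₂.eval η

/-- The two outcomes of a probabilistic choice. -/
inductive Dir : Type
  | L
  | R
  deriving DecidableEq

instance : Fintype Dir := ⟨{.L, .R}, fun d => by cases d <;> simp⟩

/-- What remains to be executed: nothing (`↓`), a program, or `c; Q` where `c` is itself such a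
remainder (so that `↓; Q` is available). -/
inductive Ctrl : Type
  | halt
  | run (P : Prog)
  | seq (c : Ctrl) (Q : Prog)

/-- Program states `⟨c, η, a, θ⟩`: remaining program, valuation, probability of the choices made so
far, and the sequence of these choices. -/
structure State where
  ctrl : Ctrl
  val : Val
  prob : ℚ≥0
  hist : List Dir

/-- `nextProg η a θ P b` is the one-step successor of `⟨P, η, a, θ⟩` whose choice sequence is `θ · b`,
where `b = none` stands for the empty word. An assigned value is cut off at `0`
(`Rat.toNNRat q = max q 0`); the difference `1 - p` is exact, as `p ≤ 1`. -/
def nextProg (η : Val) (a : ℚ≥0) (θ : List Dir) : Prog → Option Dir → Option State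
  | .assign v e, none => some ⟨.halt, Function.update η v (e.eval η).toNNRat, a, θ⟩
  | .seq P Q, b => (nextProg η a θ P b).map fun τ => { τ with ctrl := .seq τ.ctrl Q }
  | .choice p P _, some .L => some ⟨.run P, η, a * p.value, θ ++ [.L]⟩
  | .choice p _ Q, some .R => some ⟨.run Q, η, a * (1 - p.value), θ ++ [.R]⟩
  | .while c P, none =>
    if c.eval η then some ⟨.run (.seq P (.while c P)), η, a, θ⟩ else some ⟨.halt, η, a, θ⟩
  | _, _ => none

/-- Extension of `nextProg` to all remainders: `↓; Q` steps to `Q`, and `↓` has no successor. -/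
def nextCtrl (η : Val) (a : ℚ≥0) (θ : List Dir) : Ctrl → Option Dir → Option State
  | .halt, _ => none
  | .run P, b => nextProg η a θ P b
  | .seq .halt Q, none => some ⟨.run Q, η, a, θ⟩
  | .seq .halt _, some _ => none
  | .seq c Q, b => (nextCtrl η a θ c b).map fun τ => { τ with ctrl := .seq τ.ctrl Q }

/-- The one-step successor of a state whose choice sequence is extended by `b`, if there is one. -/
def State.next (σ : State) (b : Option Dir) : Option State :=
  nextCtrl σ.val σ.prob σ.hist σ.ctrl b

/-- The state successor function `T_k(σ, w)`: the state reached from `σ` in exactly `k` steps when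
the probabilistic choices are resolved by exactly the word `w`; `none` stands for `⊥`. -/
def T : ℕ → State → List Dir → Option State
  | 0, σ, [] => some σ
  | 0, _, _ :: _ => none
  | k + 1, σ, w =>
    match σ.next none, w with
    | some τ, w => T k τ w
    | none, [] => none
    | none, b :: w' => (σ.next (some b)).bind fun τ => T k τ w'

/-- The probability stored in a terminal state, and `0` for any other state and for `⊥`. -/
def alpha : Option State → ℚ≥0
  | some ⟨.halt, _, a, _⟩ => a
  | _ => 0

/-- The initial state of `P` on input `η`. -/
def init (P : Prog) (η : Val) : State := ⟨.run P, η, 1, []⟩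

/-- The probability that `P` terminates on input `η`:
`∑_k ∑_{w ∈ {L,R}^{≤ k}} α (T_k (σ_{P,η}, w))`, as a sum in `[0, ∞]`. -/
noncomputable def termProb (P : Prog) (η : Val) : ℝ≥0∞ :=
  ∑' k : ℕ, ∑ i ∈ Finset.range (k + 1), ∑ w : Fin i → Dir,
    (((alpha (T k (init P η) (List.ofFn w)) : ℚ≥0) : ℝ≥0) : ℝ≥0∞)

/-- `P` terminates almost surely on input `η`. -/
def TerminatesAS (P : Prog) (η : Val) : Prop := termProb P η = 1

/-- Finite presentation of an input: the `v`-th entry of the list is the value of the variable `v`,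
and variables beyond the list have the value `0`. -/
def inputOf (l : List FracLit) : Val := fun v => (l.getD v (0, 0)).value

/-- The problem of almost-sure termination on a given (finitely presented) input. -/
def AST (x : Prog × List FracLit) : Prop := TerminatesAS x.1 (inputOf x.2)

/-- The problem of universal almost-sure termination: almost-sure termination on every input. -/
def UAST (P : Prog) : Prop := ∀ η : Val, TerminatesAS P η

/-! ### Arithmetical hierarchy -/

/-- `A` is a `Π⁰₂` set: `A = {x | ∀ y₁, ∃ y₂, (x, y₁, y₂) ∈ R}` for a decidable relation `R`. -/
def IsPi02 {α : Type} [Primcodable α] (A : α → Prop) : Prop :=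
  ∃ R : α × ℕ × ℕ → Prop, ComputablePred R ∧ ∀ x, A x ↔ ∀ y₁, ∃ y₂, R (x, y₁, y₂)

/-- `A` is `Π⁰₂`-complete: it is a `Π⁰₂` set, and every `Π⁰₂` set many-one reduces to it. -/
def IsPi02Complete {α : Type} [Primcodable α] (A : α → Prop) : Prop :=
  IsPi02 A ∧ ∀ (β : Type) [Primcodable β] (C : β → Prop), IsPi02 C → ManyOneReducible C A

end PGCL

/-!
The probability of halting within `n` steps is a computable nondecreasing sequence of rationals, so
almost-sure termination says that for every `m` some `n` brings it above `1 - 1 / (m + 1)`. A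
program reads only finitely many variables, so termination on every input is termination on every
finite list of fractions, and this quantifier merges with the one over `m`: both problems are
`Π⁰₂`.

For hardness, write a `Π⁰₂` set as `{x | ∀ y, ∃ k, G (y, x, k) = 0}` with `G` primitive recursive.
A loop leaving with probability `1 / 2` at each round chooses every `y` with positive probability;
after it, the program searches for `k` deterministically. It terminates almost surely if and only if
no `y` makes the search diverge, and it does so regardless of the input, which settles both
problems at once.
-/

namespace PGCL

open scoped NNRat NNReal ENNReal

/-! ### Termination probability by number of steps -/

/-- The probability that the remainder `c` with valuation `η` halts after exactly `k` steps. -/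
def haltIn : ℕ → Ctrl → Val → ℚ≥0
  | 0, .halt, _ => 1
  | 0, _, _ => 0
  | k + 1, c, η =>
    match nextCtrl η 1 [] c none with
    | some τ => τ.prob * haltIn k τ.ctrl τ.val
    | none => ∑ b : Dir, (nextCtrl η 1 [] c (some b)).elim 0
        fun τ => τ.prob * haltIn k τ.ctrl τ.val

/-- The probability that the remainder `c` with valuation `η` halts in fewer than `n` steps. -/
def haltBefore (n : ℕ) (c : Ctrl) (η : Val) : ℚ≥0 := ∑ k ∈ Finset.range n, haltIn k c η

theorem haltIn_zero {c : Ctrl} (hc : c ≠ .halt) (η : Val) : haltIn 0 c η = 0 := by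
  cases c <;> simp [haltIn] at hc ⊢

theorem haltIn_succ_of_some {c : Ctrl} {η : Val} {τ : State}
    (h : nextCtrl η 1 [] c none = some τ) (k : ℕ) :
    haltIn (k + 1) c η = τ.prob * haltIn k τ.ctrl τ.val := by
  simp only [haltIn, h]

theorem haltIn_succ_of_none {c : Ctrl} {η : Val} (h : nextCtrl η 1 [] c none = none) (k : ℕ) :
    haltIn (k + 1) c η = ∑ b : Dir, (nextCtrl η 1 [] c (some b)).elim 0
      fun τ => τ.prob * haltIn k τ.ctrl τ.val := by
  simp only [haltIn, h]

theorem haltIn_congr {c c' : Ctrl} (hc : c ≠ .halt) (hc' : c' ≠ .halt) {η : Val}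
    (h : ∀ b, nextCtrl η 1 [] c b = nextCtrl η 1 [] c' b) (k : ℕ) :
    haltIn k c η = haltIn k c' η := by
  cases k with
  | zero => rw [haltIn_zero hc, haltIn_zero hc']
  | succ k => simp only [haltIn, h]

/-- Prefix the run leading to `τ` by one of probability `a` with choices `θ`. -/
def State.prepend (a : ℚ≥0) (θ : List Dir) (τ : State) : State :=
  ⟨τ.ctrl, τ.val, a * τ.prob, θ ++ τ.hist⟩

theorem nextProg_eq_map_prepend (η : Val) (a : ℚ≥0) (θ : List Dir) (P : Prog) (b : Option Dir) :
    nextProg η a θ P b = (nextProg η 1 [] P b).map (State.prepend a θ) := by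
  induction P with
  | assign v e => cases b <;> simp [nextProg, State.prepend]
  | seq P Q ihP _ =>
    simp only [nextProg]
    rw [ihP]
    cases nextProg η 1 [] P b <;> simp [State.prepend]
  | choice p P Q => rcases b with _ | _ | _ <;> simp [nextProg, State.prepend]
  | _ c P =>
    rcases b with _ | b <;> simp only [nextProg]
    · split_ifs <;> simp [State.prepend]
    · simp

theorem nextCtrl_seq {c : Ctrl} (hc : c ≠ .halt) (η : Val) (a : ℚ≥0) (θ : List Dir) (Q : Prog)
    (b : Option Dir) : nextCtrl η a θ (.seq c Q) b =
      (nextCtrl η a θ c b).map fun τ => { τ with ctrl := .seq τ.ctrl Q } := by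
  cases c with
  | halt => exact absurd rfl hc
  | run P => cases b <;> rfl
  | seq c R => cases b <;> rfl

theorem nextCtrl_eq_map_prepend (η : Val) (a : ℚ≥0) (θ : List Dir) (c : Ctrl) (b : Option Dir) :
    nextCtrl η a θ c b = (nextCtrl η 1 [] c b).map (State.prepend a θ) := by
  induction c with
  | halt => simp [nextCtrl]
  | run P => simpa [nextCtrl] using nextProg_eq_map_prepend η a θ P b
  | seq c Q ih =>
    by_cases hc : c = .halt
    · subst hc
      rcases b with _ | b <;> simp [nextCtrl, State.prepend]
    · rw [nextCtrl_seq hc, nextCtrl_seq hc, ih]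
      cases nextCtrl η 1 [] c b <;> simp [State.prepend]

theorem State.next_eq_map_prepend (σ : State) (b : Option Dir) :
    σ.next b = (nextCtrl σ.val 1 [] σ.ctrl b).map (State.prepend σ.prob σ.hist) :=
  nextCtrl_eq_map_prepend ..

theorem T_succ_of_some {σ τ : State} (h : σ.next none = some τ) (k : ℕ) (w : List Dir) :
    T (k + 1) σ w = T k τ w := by
  simp [T, h]

theorem T_succ_nil_of_none {σ : State} (h : σ.next none = none) (k : ℕ) :
    T (k + 1) σ [] = none := by
  simp [T, h]

theorem T_succ_cons_of_none {σ : State} (h : σ.next none = none) (k : ℕ) (b : Dir)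
    (w : List Dir) : T (k + 1) σ (b :: w) = (σ.next (some b)).bind fun τ => T k τ w := by
  simp [T, h]

theorem T_eq_none_of_lt_length {k : ℕ} {w : List Dir} (h : k < w.length) (σ : State) :
    T k σ w = none := by
  induction k generalizing σ w with
  | zero => cases w with
    | nil => simp at h
    | cons b w => rfl
  | succ k ih =>
    cases hn : σ.next none with
    | some τ => rw [T_succ_of_some hn, ih (by omega)]
    | none =>
      cases w with
      | nil => exact T_succ_nil_of_none hn k
      | cons b w =>
        rw [T_succ_cons_of_none hn]
        cases σ.next (some b) with
        | none => rfl
        | some τ => exact ih (by simpa using h) τ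

theorem sum_pi_fin_succ {α M : Type*} [Fintype α] [AddCommMonoid M] (n : ℕ)
    (f : (Fin (n + 1) → α) → M) :
    ∑ w, f w = ∑ a, ∑ w : Fin n → α, f (Fin.cons a w) := by
  rw [← (Fin.consEquiv fun _ => α).sum_comp, Fintype.sum_prod_type]
  rfl

theorem sum_alpha_T (k : ℕ) (σ : State) :
    ∑ i ∈ Finset.range (k + 1), ∑ w : Fin i → Dir, alpha (T k σ (List.ofFn w)) =
      σ.prob * haltIn k σ.ctrl σ.val := by
  induction k generalizing σ with
  | zero => rcases σ with ⟨_ | _ | _, η, a, θ⟩ <;> simp [T, haltIn, alpha]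
  | succ k ih =>
    have hnext := σ.next_eq_map_prepend
    cases h : nextCtrl σ.val 1 [] σ.ctrl none with
    | some τ =>
      have h_long (w : Fin (k + 1) → Dir) (τ : State) : alpha (T k τ (List.ofFn w)) = 0 := by
        rw [T_eq_none_of_lt_length (by simp)]
        rfl
      simp only [T_succ_of_some ((hnext none).trans (congrArg _ h))]
      rw [Finset.sum_range_succ, ih, haltIn_succ_of_some h,
        Finset.sum_eq_zero fun w _ => h_long w _]
      simp [State.prepend, mul_assoc]
    | none =>
      have h' : σ.next none = none := (hnext none).trans (congrArg _ h)
      have h_none : alpha none = 0 := rfl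
      rw [Finset.sum_range_succ', haltIn_succ_of_none h, Finset.mul_sum]
      simp only [sum_pi_fin_succ, List.ofFn_cons, T_succ_cons_of_none h', hnext]
      rw [Finset.sum_comm]
      simp only [List.ofFn_zero, T_succ_nil_of_none h', h_none, Finset.sum_const_zero, add_zero]
      refine Finset.sum_congr rfl fun b _ => ?_
      cases nextCtrl σ.val 1 [] σ.ctrl (some b) with
      | none => simp [h_none]
      | some τ => simpa [State.prepend, mul_assoc] using ih (τ.prepend σ.prob σ.hist)

theorem termProb_eq_iSup_haltBefore (P : Prog) (η : Val) :
    termProb P η = ⨆ n, (((haltBefore n (.run P) η : ℚ≥0) : ℝ≥0) : ℝ≥0∞) := by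
  rw [termProb, ENNReal.tsum_eq_iSup_nat]
  refine iSup_congr fun n => ?_
  rw [haltBefore, NNRat.cast_sum, ENNReal.ofNNReal_finsetSum]
  refine Finset.sum_congr rfl fun k _ => ?_
  have h : ∑ i ∈ Finset.range (k + 1), ∑ w : Fin i → Dir, alpha (T k (init P η) (List.ofFn w)) =
      haltIn k (.run P) η := (sum_alpha_T k _).trans (one_mul _)
  simp only [← h, NNRat.cast_sum, ENNReal.ofNNReal_finsetSum]

theorem haltBefore_mono {n n' : ℕ} (h : n ≤ n') (c : Ctrl) (η : Val) :
    haltBefore n c η ≤ haltBefore n' c η :=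
  Finset.sum_le_sum_of_subset (Finset.range_subset_range.2 h)

theorem haltBefore_zero (c : Ctrl) (η : Val) : haltBefore 0 c η = 0 := by simp [haltBefore]

theorem haltBefore_succ_halt (n : ℕ) (η : Val) : haltBefore (n + 1) .halt η = 1 := by
  rw [haltBefore, Finset.sum_range_succ']
  simp [haltIn, nextCtrl]

theorem haltBefore_succ_of_some {c : Ctrl} (hc : c ≠ .halt) {η : Val} {τ : State}
    (h : nextCtrl η 1 [] c none = some τ) (n : ℕ) :
    haltBefore (n + 1) c η = τ.prob * haltBefore n τ.ctrl τ.val := by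
  simp only [haltBefore, Finset.sum_range_succ', haltIn_zero hc, haltIn_succ_of_some h,
    Finset.mul_sum, add_zero]

theorem haltBefore_succ_of_none {c : Ctrl} (hc : c ≠ .halt) {η : Val}
    (h : nextCtrl η 1 [] c none = none) (n : ℕ) :
    haltBefore (n + 1) c η = ∑ b : Dir, (nextCtrl η 1 [] c (some b)).elim 0
      fun τ => τ.prob * haltBefore n τ.ctrl τ.val := by
  simp only [haltBefore, Finset.sum_range_succ', haltIn_zero hc, haltIn_succ_of_none h, add_zero]
  rw [Finset.sum_comm]
  refine Finset.sum_congr rfl fun b _ => ?_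
  cases nextCtrl η 1 [] c (some b) <;> simp [Finset.mul_sum]

/-! ### A stack machine with the same termination probability -/

/-- The probability that the stack machine with stack `s` and valuation `η` empties its stack
within `n` steps. Unlike in the step semantics, splitting `P; Q` costs a step and popping the next
program from the stack costs none. -/
def stackHalt : ℕ → List Prog → Val → ℚ≥0
  | _, [], _ => 1
  | 0, _ :: _, _ => 0
  | n + 1, .assign v e :: s, η => stackHalt n s (Function.update η v (e.eval η).toNNRat)
  | n + 1, .seq P Q :: s, η => stackHalt n (P :: Q :: s) η
  | n + 1, .choice p P Q :: s, η =>
    p.value * stackHalt n (P :: s) η + (1 - p.value) * stackHalt n (Q :: s) η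
  | n + 1, .while b P :: s, η =>
    if b.eval η then stackHalt n (P :: .while b P :: s) η else stackHalt n s η

@[simp] theorem stackHalt_nil (n : ℕ) (η : Val) : stackHalt n [] η = 1 := by
  cases n <;> rfl

theorem stackHalt_le_succ (n : ℕ) (s : List Prog) (η : Val) :
    stackHalt n s η ≤ stackHalt (n + 1) s η := by
  induction n generalizing s η with
  | zero => cases s <;> simp [stackHalt]
  | succ n ih =>
    rcases s with _ | ⟨_ | _ | _ | _, s⟩
    · simp
    · exact ih _ _
    · exact ih _ _
    · rw [stackHalt, stackHalt]
      gcongr <;> exact ih _ _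
    · rw [stackHalt, stackHalt]
      split_ifs <;> exact ih _ _

theorem stackHalt_mono {n n' : ℕ} (h : n ≤ n') (s : List Prog) (η : Val) :
    stackHalt n s η ≤ stackHalt n' s η :=
  monotone_nat_of_le_succ (fun n => stackHalt_le_succ n s η) h

theorem stackHalt_le_one (n : ℕ) (s : List Prog) (η : Val) : stackHalt n s η ≤ 1 := by
  induction n generalizing s η with
  | zero => cases s <;> simp [stackHalt]
  | succ n ih =>
    rcases s with _ | ⟨_ | _ | ⟨p, P, Q⟩ | _, s⟩
    · simp
    · exact ih _ _
    · exact ih _ _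
    · rw [stackHalt]
      calc _ ≤ p.value * 1 + (1 - p.value) * 1 := by gcongr <;> exact ih _ _
        _ = 1 := by rw [mul_one, mul_one, add_tsub_cancel_of_le p.value_le_one]
    · rw [stackHalt]
      split_ifs <;> exact ih _ _

/-- The remainder `c; Q₁; …; Qₘ`, associated to the left, for the stack `[Q₁, …, Qₘ]`. -/
def resume (c : Ctrl) (s : List Prog) : Ctrl := s.foldl .seq c

theorem resume_ne_halt {c : Ctrl} (hc : c ≠ .halt) (s : List Prog) : resume c s ≠ .halt := by
  induction s generalizing c with
  | nil => exact hc
  | cons Q _ ih => exact ih (c := .seq c Q) (by simp)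

theorem nextCtrl_resume {c : Ctrl} (hc : c ≠ .halt) (η : Val) (a : ℚ≥0) (θ : List Dir)
    (s : List Prog) (b : Option Dir) : nextCtrl η a θ (resume c s) b =
      (nextCtrl η a θ c b).map fun τ => { τ with ctrl := resume τ.ctrl s } := by
  induction s generalizing c with
  | nil => simp [resume]
  | cons Q s ih =>
    change nextCtrl η a θ (resume (.seq c Q) s) b = _
    rw [ih (by simp), nextCtrl_seq hc]
    cases nextCtrl η a θ c b <;> simp [resume]

theorem haltBefore_succ_resume_of_some {c : Ctrl} (hc : c ≠ .halt) {η : Val} {τ : State}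
    (h : nextCtrl η 1 [] c none = some τ) (n : ℕ) (s : List Prog) :
    haltBefore (n + 1) (resume c s) η = τ.prob * haltBefore n (resume τ.ctrl s) τ.val :=
  haltBefore_succ_of_some (τ := { τ with ctrl := resume τ.ctrl s }) (resume_ne_halt hc s)
    (by rw [nextCtrl_resume hc, h]; rfl) n

theorem haltBefore_resume_halt_cons (n : ℕ) (Q : Prog) (s : List Prog) (η : Val) :
    haltBefore (n + 1) (resume .halt (Q :: s)) η = haltBefore n (resume (.run Q) s) η :=
  (haltBefore_succ_resume_of_some (c := .seq .halt Q) (by simp) rfl n s).trans (one_mul _)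

theorem haltBefore_resume_assign (n : ℕ) (v : Var) (e : AExp) (s : List Prog) (η : Val) :
    haltBefore (n + 1) (resume (.run (.assign v e)) s) η =
      haltBefore n (resume .halt s) (Function.update η v (e.eval η).toNNRat) :=
  (haltBefore_succ_resume_of_some (by simp) rfl n s).trans (one_mul _)

theorem haltBefore_resume_seq (n : ℕ) (P Q : Prog) (s : List Prog) (η : Val) :
    haltBefore n (resume (.run (.seq P Q)) s) η = haltBefore n (resume (.run P) (Q :: s)) η := by
  refine Finset.sum_congr rfl fun k _ => ?_
  refine haltIn_congr (resume_ne_halt (by simp) s) (resume_ne_halt (by simp) _) (fun b => ?_) k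
  change _ = nextCtrl η 1 [] (resume (.seq (.run P) Q) s) b
  rw [nextCtrl_resume (by simp), nextCtrl_resume (by simp), nextCtrl_seq (by simp)]
  rfl

theorem haltBefore_resume_choice (n : ℕ) (p : ProbLit) (P Q : Prog) (s : List Prog) (η : Val) :
    haltBefore (n + 1) (resume (.run (.choice p P Q)) s) η =
      p.value * haltBefore n (resume (.run P) s) η +
        (1 - p.value) * haltBefore n (resume (.run Q) s) η := by
  have h (b : Option Dir) : nextCtrl η 1 [] (resume (.run (.choice p P Q)) s) b =
      (nextProg η 1 [] (.choice p P Q) b).map fun τ => { τ with ctrl := resume τ.ctrl s } :=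
    nextCtrl_resume (by simp) η 1 [] s b
  have h_univ : (Finset.univ : Finset Dir) = {.L, .R} := rfl
  rw [haltBefore_succ_of_none (resume_ne_halt (by simp) s) (h none), h_univ,
    Finset.sum_pair (by decide), h, h]
  simp [nextProg]

theorem haltBefore_resume_while (n : ℕ) (b : BExp) (P : Prog) (s : List Prog) (η : Val) :
    haltBefore (n + 1) (resume (.run (.while b P)) s) η =
      if b.eval η then haltBefore n (resume (.run P) (.while b P :: s)) η
      else haltBefore n (resume .halt s) η := by
  split_ifs with hb
  · rw [haltBefore_succ_resume_of_some (τ := ⟨.run (.seq P (.while b P)), η, 1, []⟩) (by simp)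
      (by simp [nextCtrl, nextProg, hb]), haltBefore_resume_seq, one_mul]
  · rw [haltBefore_succ_resume_of_some (τ := ⟨.halt, η, 1, []⟩) (by simp)
      (by simp [nextCtrl, nextProg, hb]), one_mul]

theorem stackHalt_le_haltBefore (n : ℕ) (s : List Prog) (η : Val) :
    stackHalt n s η ≤ haltBefore (2 * n + 1) (resume .halt s) η := by
  induction n generalizing s η with
  | zero =>
    cases s with
    | nil => exact (haltBefore_succ_halt 0 η).ge
    | cons P s => exact zero_le
  | succ n ih =>
    have ih' (s : List Prog) (η : Val) :
        stackHalt n s η ≤ haltBefore (2 * n + 2) (resume .halt s) η :=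
      (ih s η).trans (haltBefore_mono (Nat.le_succ _) _ _)
    rcases s with _ | ⟨_ | _ | _ | _, s⟩
    · exact (stackHalt_nil _ _).trans_le (haltBefore_succ_halt _ η).ge
    all_goals rw [stackHalt, mul_add_one, haltBefore_resume_halt_cons]
    · rw [haltBefore_resume_assign]
      exact ih _ _
    · rw [haltBefore_resume_seq, ← haltBefore_resume_halt_cons]
      exact (ih' _ _).trans (haltBefore_mono (Nat.le_succ _) _ _)
    · rw [haltBefore_resume_choice, ← haltBefore_resume_halt_cons, ← haltBefore_resume_halt_cons]
      gcongr <;> exact ih' _ _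
    · rw [haltBefore_resume_while, ← haltBefore_resume_halt_cons]
      split_ifs
      exacts [ih' _ _, ih _ _]

theorem exists_haltBefore_le_stackHalt (n : ℕ) (s : List Prog) (η : Val) :
    ∃ m, haltBefore n (resume .halt s) η ≤ stackHalt m s η := by
  induction n generalizing s η with
  | zero => exact ⟨0, by simp [haltBefore_zero]⟩
  | succ n ih =>
    cases s with
    | nil => exact ⟨0, (haltBefore_succ_halt n η).le⟩
    | cons P s =>
      simp only [haltBefore_resume_halt_cons]
      induction P generalizing η s with
      | assign v e =>
        obtain ⟨m, hm⟩ := ih s (Function.update η v (e.eval η).toNNRat)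
        refine ⟨m + 1, (haltBefore_mono n.le_succ _ _).trans ?_⟩
        rwa [haltBefore_resume_assign]
      | seq P Q ihP _ =>
        obtain ⟨m, hm⟩ := ihP η (Q :: s)
        exact ⟨m + 1, by rwa [haltBefore_resume_seq]⟩
      | choice p P Q ihP ihQ =>
        obtain ⟨m, hm⟩ := ihP η s
        obtain ⟨m', hm'⟩ := ihQ η s
        refine ⟨max m m' + 1, (haltBefore_mono n.le_succ _ _).trans ?_⟩
        rw [haltBefore_resume_choice, stackHalt]
        gcongr
        · exact hm.trans (stackHalt_mono (le_max_left _ _) _ _)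
        · exact hm'.trans (stackHalt_mono (le_max_right _ _) _ _)
      | _ b P ihP =>
        have h_mono := haltBefore_mono n.le_succ (resume (.run (.while b P)) s) η
        rw [haltBefore_resume_while] at h_mono
        split_ifs at h_mono with hb
        · obtain ⟨m, hm⟩ := ihP η (.while b P :: s)
          exact ⟨m + 1, h_mono.trans (by rwa [stackHalt, if_pos hb])⟩
        · obtain ⟨m, hm⟩ := ih s η
          exact ⟨m + 1, h_mono.trans (by rwa [stackHalt, if_neg hb])⟩

theorem termProb_eq_iSup_stackHalt (P : Prog) (η : Val) :
    termProb P η = ⨆ n, (((stackHalt n [P] η : ℚ≥0) : ℝ≥0) : ℝ≥0∞) := by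
  rw [termProb_eq_iSup_haltBefore]
  apply le_antisymm <;> refine iSup_le fun n => ?_
  · obtain ⟨m, hm⟩ := exists_haltBefore_le_stackHalt (n + 1) [P] η
    rw [haltBefore_resume_halt_cons] at hm
    exact le_iSup_of_le m (by exact_mod_cast hm)
  · have h := stackHalt_le_haltBefore n [P] η
    rw [haltBefore_resume_halt_cons] at h
    exact le_iSup_of_le (2 * n) (by exact_mod_cast h)

theorem iSup_coe_eq_one_iff {u : ℕ → ℚ≥0} (hu : ∀ n, u n ≤ 1) :
    ⨆ n, (((u n : ℚ≥0) : ℝ≥0) : ℝ≥0∞) = 1 ↔ ∀ ε : ℚ≥0, 0 < ε → ∃ n, 1 < u n + ε := by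
  have h_le : ⨆ n, (((u n : ℚ≥0) : ℝ≥0) : ℝ≥0∞) ≤ 1 := iSup_le fun n => by exact_mod_cast hu n
  constructor
  · intro h ε hε
    obtain ⟨n, hn⟩ : ∃ n, (1 : ℝ≥0∞) - (ε : ℝ≥0) < (u n : ℝ≥0) := by
      rw [← lt_iSup_iff, h]
      exact ENNReal.sub_lt_self (by simp) (by simp) (by simpa using hε.ne')
    exact ⟨n, by exact_mod_cast ENNReal.lt_add_of_sub_lt_right (.inl (by simp)) hn⟩
  · intro h
    refine h_le.antisymm (le_of_forall_lt fun c hc => ?_)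
    obtain ⟨q, hq₀, hcq, hq₁⟩ := ENNReal.lt_iff_exists_rat_btwn.1 hc
    lift q to ℚ≥0 using hq₀
    have hq : Real.toNNReal ((q : ℚ) : ℝ) = (q : ℝ≥0) := by
      exact_mod_cast Real.toNNReal_coe (r := (q : ℝ≥0))
    rw [hq] at hcq hq₁
    have hq₁' : q < 1 := by exact_mod_cast hq₁
    obtain ⟨n, hn⟩ := h (1 - q) (tsub_pos_of_lt hq₁')
    have hqn : q < u n :=
      lt_of_add_lt_add_right ((add_tsub_cancel_of_le hq₁'.le).trans_lt hn)
    have hqn' : ((q : ℝ≥0) : ℝ≥0∞) < (u n : ℝ≥0) := by exact_mod_cast hqn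
    exact hcq.trans (hqn'.trans_le (le_iSup (fun n => ((u n : ℝ≥0) : ℝ≥0∞)) n))

theorem terminatesAS_iff (P : Prog) (η : Val) :
    TerminatesAS P η ↔ ∀ ε : ℚ≥0, 0 < ε → ∃ n, 1 < stackHalt n [P] η + ε := by
  rw [TerminatesAS, termProb_eq_iSup_stackHalt,
    iSup_coe_eq_one_iff fun n => stackHalt_le_one n [P] η]

/-! ### Primitive recursion on the syntax -/

/-- Structural recursion on arithmetical expressions. -/
def AExp.fold {σ : Type*} (lit : FracLit → σ) (var : Var → σ) (add sub mul : σ → σ → σ) :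
    AExp → σ
  | .lit q => lit q
  | .var v => var v
  | .add e₁ e₂ => add (e₁.fold lit var add sub mul) (e₂.fold lit var add sub mul)
  | .sub e₁ e₂ => sub (e₁.fold lit var add sub mul) (e₂.fold lit var add sub mul)
  | .mul e₁ e₂ => mul (e₁.fold lit var add sub mul) (e₂.fold lit var add sub mul)

/-- Structural recursion on Boolean expressions. -/
def BExp.fold {σ : Type*} (eq lt : AExp → AExp → σ) (not : σ → σ) (and : σ → σ → σ) : BExp → σ
  | .eq e₁ e₂ => eq e₁ e₂
  | .lt e₁ e₂ => lt e₁ e₂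
  | .not b => not (b.fold eq lt not and)
  | .and b₁ b₂ => and (b₁.fold eq lt not and) (b₂.fold eq lt not and)

/-- The immediate subexpressions of an arithmetical expression. -/
def AExp.children : AExp → List AExp
  | .lit _ | .var _ => []
  | .add e₁ e₂ | .sub e₁ e₂ | .mul e₁ e₂ => [e₁, e₂]

/-- The immediate Boolean subexpressions of a Boolean expression. -/
def BExp.children : BExp → List BExp
  | .eq _ _ | .lt _ _ => []
  | .not b => [b]
  | .and b₁ b₂ => [b₁, b₂]

theorem AExp.code_lt_of_mem_children {e e' : AExp} (h : e' ∈ e.children) : e'.code < e.code := by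
  cases e with
  | lit q => simp [children] at h
  | var v => simp [children] at h
  | _ x y =>
    have hx := Nat.left_le_pair x.code y.code
    have hy := Nat.right_le_pair x.code y.code
    rcases List.mem_pair.1 h with rfl | rfl <;> rw [code] <;> omega

theorem BExp.code_lt_of_mem_children {b b' : BExp} (h : b' ∈ b.children) : b'.code < b.code := by
  cases b with
  | eq x y => simp [children] at h
  | lt x y => simp [children] at h
  | not x =>
    rw [List.mem_singleton.1 h, code]
    omega
  | and x y =>
    have hx := Nat.left_le_pair x.code y.code
    have hy := Nat.right_le_pair x.code y.code
    rcases List.mem_pair.1 h with rfl | rfl <;> rw [code] <;> omega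

section PrimrecFold

variable {α σ : Type*} [Primcodable α] [Primcodable σ]

theorem primrec_unpair_div {f : α → ℕ} (hf : Primrec f) (k : ℕ) :
    Primrec fun a => Nat.unpair (f a / k) :=
  Primrec.unpair.comp (Primrec.nat_div.comp hf (.const k))

theorem primrecPred_mod_eq {f : α → ℕ} (hf : Primrec f) (k r : ℕ) :
    PrimrecPred fun a => f a % k = r :=
  Primrec.eq.comp (Primrec.nat_mod.comp hf (.const k)) (.const r)

theorem AExp.primrec_casesOn {f : α → AExp} {lit : α → FracLit → σ} {var : α → Var → σ}
    {add sub mul : α → AExp × AExp → σ} (hf : Primrec f) (h_lit : Primrec₂ lit)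
    (h_var : Primrec₂ var) (h_add : Primrec₂ add) (h_sub : Primrec₂ sub) (h_mul : Primrec₂ mul) :
    @Primrec _ σ _ _ fun a => AExp.casesOn (f a) (lit a) (var a) (fun x y => add a (x, y))
      (fun x y => sub a (x, y)) (fun x y => mul a (x, y)) := by
  have hn : Primrec fun a => (f a).code := Primrec.encode.comp hf
  have hu := primrec_unpair_div hn 5
  have hxy : Primrec fun a => (AExp.ofCode (Nat.unpair ((f a).code / 5)).1,
      AExp.ofCode (Nat.unpair ((f a).code / 5)).2) :=
    .pair ((Primrec.ofNat AExp).comp (.comp .fst hu)) ((Primrec.ofNat AExp).comp (.comp .snd hu))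
  refine (Primrec.ite (primrecPred_mod_eq hn 5 0) (h_lit.comp .id hu)
    (.ite (primrecPred_mod_eq hn 5 1) (h_var.comp .id (Primrec.nat_div.comp hn (.const 5)))
    (.ite (primrecPred_mod_eq hn 5 2) (h_add.comp .id hxy)
    (.ite (primrecPred_mod_eq hn 5 3) (h_sub.comp .id hxy) (h_mul.comp .id hxy))))).of_eq
    fun a => ?_
  cases f a <;> simp [AExp.code, AExp.ofCode_code, Nat.mul_add_div]

theorem BExp.primrec_casesOn {f : α → BExp} {eq lt : α → AExp × AExp → σ} {not : α → BExp → σ}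
    {and : α → BExp × BExp → σ} (hf : Primrec f) (h_eq : Primrec₂ eq) (h_lt : Primrec₂ lt)
    (h_not : Primrec₂ not) (h_and : Primrec₂ and) :
    @Primrec _ σ _ _ fun a => BExp.casesOn (f a) (fun x y => eq a (x, y))
      (fun x y => lt a (x, y)) (not a) (fun x y => and a (x, y)) := by
  have hn : Primrec fun a => (f a).code := Primrec.encode.comp hf
  have hu := primrec_unpair_div hn 4
  have hxy : Primrec fun a => (AExp.ofCode (Nat.unpair ((f a).code / 4)).1,
      AExp.ofCode (Nat.unpair ((f a).code / 4)).2) :=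
    .pair ((Primrec.ofNat AExp).comp (.comp .fst hu)) ((Primrec.ofNat AExp).comp (.comp .snd hu))
  have hxy' : Primrec fun a => (BExp.ofCode (Nat.unpair ((f a).code / 4)).1,
      BExp.ofCode (Nat.unpair ((f a).code / 4)).2) :=
    .pair ((Primrec.ofNat BExp).comp (.comp .fst hu)) ((Primrec.ofNat BExp).comp (.comp .snd hu))
  have hx : Primrec fun a => BExp.ofCode ((f a).code / 4) :=
    (Primrec.ofNat BExp).comp (Primrec.nat_div.comp hn (.const 4))
  refine (Primrec.ite (primrecPred_mod_eq hn 4 0) (h_eq.comp .id hxy)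
    (.ite (primrecPred_mod_eq hn 4 1) (h_lt.comp .id hxy)
    (.ite (primrecPred_mod_eq hn 4 2) (h_not.comp .id hx) (h_and.comp .id hxy')))).of_eq
    fun a => ?_
  cases f a <;>
    simp [BExp.code, AExp.ofCode_code, BExp.ofCode_code, Nat.mul_add_div]

theorem Prog.primrec_casesOn {f : α → Prog} {assign : α → Var × AExp → σ}
    {seq : α → Prog × Prog → σ} {choice : α → ProbLit × Prog × Prog → σ}
    {loop : α → BExp × Prog → σ} (hf : Primrec f) (h_assign : Primrec₂ assign)
    (h_seq : Primrec₂ seq) (h_choice : Primrec₂ choice) (h_loop : Primrec₂ loop) :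
    @Primrec _ σ _ _ fun a => Prog.casesOn (f a) (fun v e => assign a (v, e))
      (fun P Q => seq a (P, Q)) (fun p P Q => choice a (p, P, Q)) (fun b P => loop a (b, P)) := by
  have hn : Primrec fun a => (f a).code := Primrec.encode.comp hf
  have hu := primrec_unpair_div hn 4
  have hu₁ := Primrec.fst.comp hu
  have hu₂ := Primrec.snd.comp hu
  have huu := Primrec.unpair.comp hu₂
  refine (Primrec.ite (primrecPred_mod_eq hn 4 0)
      (h_assign.comp .id (.pair hu₁ ((Primrec.ofNat AExp).comp hu₂)))
    (.ite (primrecPred_mod_eq hn 4 1)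
      (h_seq.comp .id (.pair ((Primrec.ofNat Prog).comp hu₁) ((Primrec.ofNat Prog).comp hu₂)))
    (.ite (primrecPred_mod_eq hn 4 2)
      (h_choice.comp .id (.pair ((Primrec.ofNat ProbLit).comp hu₁)
        (.pair ((Primrec.ofNat Prog).comp (.comp .fst huu))
          ((Primrec.ofNat Prog).comp (.comp .snd huu)))))
      (h_loop.comp .id
        (.pair ((Primrec.ofNat BExp).comp hu₁) ((Primrec.ofNat Prog).comp hu₂)))))).of_eq
    fun a => ?_
  have h_prob (p : ProbLit) : Denumerable.ofNat ProbLit (ProbLit.equivNat p) = p :=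
    ProbLit.equivNat.symm_apply_apply p
  have h_aexp (e : AExp) : Denumerable.ofNat AExp e.code = e := e.ofCode_code
  have h_bexp (b : BExp) : Denumerable.ofNat BExp b.code = b := b.ofCode_code
  have h_prog (P : Prog) : Denumerable.ofNat Prog P.code = P := P.ofCode_code
  cases f a <;> simp [Prog.code, h_prob, h_aexp, h_bexp, h_prog, Nat.mul_add_div]

theorem AExp.primrec_children : Primrec AExp.children := by
  have h_nil {β : Type} [Primcodable β] : Primrec₂ fun (_ : AExp) (_ : β) => ([] : List AExp) :=
    Primrec.const []
  have h_pair : Primrec₂ fun (_ : AExp) (x : AExp × AExp) => [x.1, x.2] :=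
    Primrec.list_cons.comp (.comp .fst .snd) (Primrec.list_cons.comp (.comp .snd .snd) (.const []))
  exact (AExp.primrec_casesOn .id h_nil h_nil h_pair h_pair h_pair).of_eq fun e => by
    cases e <;> rfl

theorem BExp.primrec_children : Primrec BExp.children := by
  have h_nil : Primrec₂ fun (_ : BExp) (_ : AExp × AExp) => ([] : List BExp) := Primrec.const []
  have h_pair : Primrec₂ fun (_ : BExp) (x : BExp × BExp) => [x.1, x.2] :=
    Primrec.list_cons.comp (.comp .fst .snd) (Primrec.list_cons.comp (.comp .snd .snd) (.const []))
  have h_single : Primrec₂ fun (_ : BExp) (b : BExp) => [b] :=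
    Primrec.list_cons.comp .snd (.const [])
  exact (BExp.primrec_casesOn .id h_nil h_nil h_single h_pair).of_eq fun b => by cases b <;> rfl

theorem AExp.primrec_fold [Inhabited σ] {lit : α → FracLit → σ} {var : α → Var → σ}
    {add sub mul : σ → σ → σ} (h_lit : Primrec₂ lit) (h_var : Primrec₂ var)
    (h_add : Primrec₂ add) (h_sub : Primrec₂ sub) (h_mul : Primrec₂ mul) :
    Primrec₂ fun a e => AExp.fold (lit a) (var a) add sub mul e := by
  have h_get (i : ℕ) {β : Type} [Primcodable β] :
      Primrec fun x : (α × AExp × List σ) × β => x.1.2.2.getD i default :=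
    (Primrec.list_getD default).comp (.comp .snd (.comp .snd .fst)) (.const i)
  have h_op {op : σ → σ → σ} (h : Primrec₂ op) :
      Primrec₂ fun (x : α × AExp × List σ) (_ : AExp × AExp) =>
        op (x.2.2.getD 0 default) (x.2.2.getD 1 default) :=
    h.comp (h_get 0) (h_get 1)
  have h_rec := AExp.primrec_casesOn (f := fun x : α × AExp × List σ => x.2.1)
    (lit := fun x => lit x.1) (var := fun x => var x.1) (.comp .fst .snd)
    (h_lit.comp (.comp .fst .fst) .snd) (h_var.comp (.comp .fst .fst) .snd)
    (h_op h_add) (h_op h_sub) (h_op h_mul)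
  refine Primrec.nat_omega_rec (m := fun _ => AExp.code) (l := fun _ => AExp.children) _
    (Primrec.encode.comp .snd) (AExp.primrec_children.comp .snd)
    (Primrec.option_some.comp h_rec).to₂ (fun _ _ _ h => AExp.code_lt_of_mem_children h)
    fun a e => ?_
  cases e <;> rfl

theorem BExp.primrec_fold [Inhabited σ] {eq lt : α → AExp → AExp → σ} {not : σ → σ}
    {and : σ → σ → σ} (h_eq : Primrec₂ fun a (x : AExp × AExp) => eq a x.1 x.2)
    (h_lt : Primrec₂ fun a (x : AExp × AExp) => lt a x.1 x.2) (h_not : Primrec not)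
    (h_and : Primrec₂ and) : Primrec₂ fun a b => BExp.fold (eq a) (lt a) not and b := by
  have h_get (i : ℕ) {β : Type} [Primcodable β] :
      Primrec fun x : (α × BExp × List σ) × β => x.1.2.2.getD i default :=
    (Primrec.list_getD default).comp (.comp .snd (.comp .snd .fst)) (.const i)
  have h_rec := BExp.primrec_casesOn (f := fun x : α × BExp × List σ => x.2.1)
    (eq := fun x p => eq x.1 p.1 p.2) (lt := fun x p => lt x.1 p.1 p.2)
    (not := fun x _ => not (x.2.2.getD 0 default))
    (and := fun x _ => and (x.2.2.getD 0 default) (x.2.2.getD 1 default)) (.comp .fst .snd)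
    (h_eq.comp (.comp .fst .fst) .snd) (h_lt.comp (.comp .fst .fst) .snd)
    (h_not.comp (h_get 0)) (h_and.comp (h_get 0) (h_get 1))
  refine Primrec.nat_omega_rec (m := fun _ => BExp.code) (l := fun _ => BExp.children) _
    (Primrec.encode.comp .snd) (BExp.primrec_children.comp .snd)
    (Primrec.option_some.comp h_rec).to₂ (fun _ _ _ h => BExp.code_lt_of_mem_children h)
    fun a b => ?_
  cases b <;> rfl

end PrimrecFold

/-! ### Exact arithmetic with signed fractions -/

/-- Signed fractions, used to evaluate expressions by integer arithmetic on codes: `(a, b, d)`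
denotes `(a - b) / (d + 1)`. -/
abbrev SFrac : Type := ℕ × ℕ × ℕ

namespace SFrac

/-- The rational denoted by a signed fraction. -/
def value (t : SFrac) : ℚ := ((t.1 : ℚ) - t.2.1) / (t.2.2 + 1)

/-- Addition of signed fractions. -/
def add (t u : SFrac) : SFrac :=
  (t.1 * (u.2.2 + 1) + u.1 * (t.2.2 + 1), t.2.1 * (u.2.2 + 1) + u.2.1 * (t.2.2 + 1),
    t.2.2 * u.2.2 + t.2.2 + u.2.2)

/-- Subtraction of signed fractions. -/
def sub (t u : SFrac) : SFrac := add t (u.2.1, u.1, u.2.2)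

/-- Multiplication of signed fractions. -/
def mul (t u : SFrac) : SFrac :=
  (t.1 * u.1 + t.2.1 * u.2.1, t.1 * u.2.1 + t.2.1 * u.1, t.2.2 * u.2.2 + t.2.2 + u.2.2)

/-- The fraction literal for the positive part of a signed fraction. -/
def toFracLit (t : SFrac) : FracLit := (t.1 - t.2.1, t.2.2)

theorem value_add (t u : SFrac) : (add t u).value = t.value + u.value := by
  have h_den : ((t.2.2 * u.2.2 + t.2.2 + u.2.2 : ℕ) : ℚ) + 1 = (t.2.2 + 1) * (u.2.2 + 1) := by
    push_cast
    ring
  simp only [add, value, h_den]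
  push_cast
  field_simp
  ring

theorem value_sub (t u : SFrac) : (sub t u).value = t.value - u.value := by
  rw [sub, value_add, sub_eq_add_neg, add_right_inj]
  simp only [value]
  rw [← neg_div, neg_sub]

theorem value_mul (t u : SFrac) : (mul t u).value = t.value * u.value := by
  have h_den : ((t.2.2 * u.2.2 + t.2.2 + u.2.2 : ℕ) : ℚ) + 1 = (t.2.2 + 1) * (u.2.2 + 1) := by
    push_cast
    ring
  simp only [mul, value, h_den]
  push_cast
  field_simp
  ring

theorem value_toFracLit (t : SFrac) : t.toFracLit.value = t.value.toNNRat := by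
  rcases le_total t.2.1 t.1 with h | h
  · have h_value : t.value = t.toFracLit.value := by
      rw [value, toFracLit, FracLit.value, NNRat.coe_div, NNRat.coe_natCast, Nat.cast_sub h]
      simp
    rw [h_value, NNRat.toNNRat_coe]
  · have h_value : t.value ≤ 0 :=
      div_nonpos_of_nonpos_of_nonneg (sub_nonpos.2 (by exact_mod_cast h)) (by positivity)
    rw [Rat.toNNRat_of_nonpos h_value]
    simp [toFracLit, FracLit.value, Nat.sub_eq_zero_of_le h]

theorem value_lt_iff (t u : SFrac) : t.value < u.value ↔
    t.1 * (u.2.2 + 1) + u.2.1 * (t.2.2 + 1) < u.1 * (t.2.2 + 1) + t.2.1 * (u.2.2 + 1) := by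
  have h (n : ℕ) : (0 : ℚ) < (n : ℚ) + 1 := by positivity
  rw [value, value, div_lt_div_iff₀ (h _) (h _), ← Nat.cast_lt (α := ℚ)]
  push_cast
  constructor <;> intro h <;> linarith

section Primrec

variable {α : Type*} [Primcodable α] {t u : α → SFrac}

theorem primrec_pos (ht : Primrec t) : Primrec fun a => (t a).1 := .comp .fst ht

theorem primrec_neg (ht : Primrec t) : Primrec fun a => (t a).2.1 := .comp .fst (.comp .snd ht)

theorem primrec_den (ht : Primrec t) : Primrec fun a => (t a).2.2 := .comp .snd (.comp .snd ht)

theorem primrec_cross {f g : α → ℕ} (hf : Primrec f) (hg : Primrec g) (ht : Primrec t)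
    (hu : Primrec u) : Primrec fun a => f a * ((u a).2.2 + 1) + g a * ((t a).2.2 + 1) :=
  Primrec.nat_add.comp (Primrec.nat_mul.comp hf (Primrec.succ.comp (primrec_den hu)))
    (Primrec.nat_mul.comp hg (Primrec.succ.comp (primrec_den ht)))

theorem primrec_mul_den (ht : Primrec t) (hu : Primrec u) :
    Primrec fun a => (t a).2.2 * (u a).2.2 + (t a).2.2 + (u a).2.2 :=
  Primrec.nat_add.comp (Primrec.nat_add.comp
    (Primrec.nat_mul.comp (primrec_den ht) (primrec_den hu)) (primrec_den ht)) (primrec_den hu)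

end Primrec

theorem primrec_add : Primrec₂ add :=
  Primrec.pair (primrec_cross (primrec_pos .fst) (primrec_pos .snd) .fst .snd)
    (.pair (primrec_cross (primrec_neg .fst) (primrec_neg .snd) .fst .snd)
      (primrec_mul_den .fst .snd))

theorem primrec_sub : Primrec₂ sub :=
  primrec_add.comp .fst (.pair (primrec_neg .snd) (.pair (primrec_pos .snd) (primrec_den .snd)))

theorem primrec_mul : Primrec₂ mul := by
  have h_dot {f g f' g' : SFrac × SFrac → ℕ} (hf : Primrec f) (hf' : Primrec f') (hg : Primrec g)
      (hg' : Primrec g') : Primrec fun x => f x * f' x + g x * g' x :=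
    Primrec.nat_add.comp (Primrec.nat_mul.comp hf hf') (Primrec.nat_mul.comp hg hg')
  exact Primrec.pair
    (h_dot (primrec_pos .fst) (primrec_pos .snd) (primrec_neg .fst) (primrec_neg .snd))
    (.pair (h_dot (primrec_pos .fst) (primrec_neg .snd) (primrec_neg .fst) (primrec_pos .snd))
      (primrec_mul_den .fst .snd))

theorem primrec_toFracLit : Primrec toFracLit :=
  .pair (Primrec.nat_sub.comp (primrec_pos .id) (primrec_neg .id)) (primrec_den .id)

theorem primrecRel_value_lt : PrimrecRel fun t u : SFrac => t.value < u.value :=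
  PrimrecPred.of_eq (Primrec.nat_lt.comp
    (primrec_cross (primrec_pos .fst) (primrec_neg .snd) .fst .snd)
    (primrec_cross (primrec_pos .snd) (primrec_neg .fst) .snd .fst))
    fun x => (value_lt_iff x.1 x.2).symm

theorem primrecRel_value_eq : PrimrecRel fun t u : SFrac => t.value = u.value :=
  (primrecRel_value_lt.not.and (primrecRel_value_lt.comp .snd .fst).not).of_eq fun x => by
    simp only [not_lt, le_antisymm_iff, and_comm]

end SFrac

/-- The nonnegative fraction of a literal as a signed fraction. -/
def FracLit.toSFrac (q : FracLit) : SFrac := (q.1, 0, q.2)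

theorem FracLit.value_toSFrac (q : FracLit) : q.toSFrac.value = q.value := by
  simp [toSFrac, SFrac.value, FracLit.value]

theorem FracLit.primrec_toSFrac : Primrec FracLit.toSFrac := .pair .fst (.pair (.const 0) .snd)

/-- Evaluation of an arithmetical expression on a finitely presented valuation. -/
def AExp.evalFrac (l : List FracLit) : AExp → SFrac :=
  AExp.fold FracLit.toSFrac (fun v => (l.getD v (0, 0)).toSFrac) SFrac.add SFrac.sub SFrac.mul

theorem AExp.value_evalFrac (l : List FracLit) (e : AExp) :
    (e.evalFrac l).value = e.eval (inputOf l) := by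
  induction e with
  | lit q => exact q.value_toSFrac
  | var v => exact (l.getD v (0, 0)).value_toSFrac
  | add a b iha ihb => rw [eval, ← iha, ← ihb, ← SFrac.value_add]; rfl
  | sub a b iha ihb => rw [eval, ← iha, ← ihb, ← SFrac.value_sub]; rfl
  | mul a b iha ihb => rw [eval, ← iha, ← ihb, ← SFrac.value_mul]; rfl

theorem AExp.primrec_evalFrac : Primrec₂ AExp.evalFrac :=
  AExp.primrec_fold (lit := fun _ => FracLit.toSFrac)
    (var := fun (l : List FracLit) v => (l.getD v (0, 0)).toSFrac)
    (FracLit.primrec_toSFrac.comp .snd) (FracLit.primrec_toSFrac.comp (Primrec.list_getD (0, 0)))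
    SFrac.primrec_add SFrac.primrec_sub SFrac.primrec_mul

theorem BExp.eval_eq_fold (η : Val) (b : BExp) :
    b.eval η = BExp.fold (fun e₁ e₂ => decide (e₁.eval η = e₂.eval η))
      (fun e₁ e₂ => decide (e₁.eval η < e₂.eval η)) (!·) (· && ·) b := by
  induction b with
  | eq | lt => rfl
  | not b ih => rw [eval, ih]; rfl
  | and b₁ b₂ ih₁ ih₂ => rw [eval, ih₁, ih₂]; rfl

theorem BExp.primrec_eval : Primrec₂ fun (l : List FracLit) (b : BExp) => b.eval (inputOf l) := by
  have h_left : Primrec fun x : List FracLit × AExp × AExp => x.2.1.evalFrac x.1 :=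
    AExp.primrec_evalFrac.comp .fst (.comp .fst .snd)
  have h_right : Primrec fun x : List FracLit × AExp × AExp => x.2.2.evalFrac x.1 :=
    AExp.primrec_evalFrac.comp .fst (.comp .snd .snd)
  refine (BExp.primrec_fold
    (eq := fun l e₁ e₂ => decide ((e₁.evalFrac l).value = (e₂.evalFrac l).value))
    (lt := fun l e₁ e₂ => decide ((e₁.evalFrac l).value < (e₂.evalFrac l).value))
    (SFrac.primrecRel_value_eq.comp h_left h_right).decide
    (SFrac.primrecRel_value_lt.comp h_left h_right).decide Primrec.not Primrec.and).of_eq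
    fun l b => ?_
  simp only [AExp.value_evalFrac, BExp.eval_eq_fold]

/-! ### Breadth-first execution -/

/-- Update of a finitely presented valuation, padding the list with zeros up to index `v`. -/
def updateInput (l : List FracLit) (v : Var) (q : FracLit) : List FracLit :=
  (List.range (max l.length (v + 1))).map fun w => if w = v then q else l.getD w (0, 0)

theorem inputOf_updateInput (l : List FracLit) (v : Var) (q : FracLit) :
    inputOf (updateInput l v q) = Function.update (inputOf l) v q.value := by
  funext w
  rw [inputOf, Function.update_apply]
  by_cases hw : w < max l.length (v + 1)
  · have h_get : (updateInput l v q).getD w (0, 0) = if w = v then q else l.getD w (0, 0) := by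
      simp [updateInput, List.getD, hw]
    rw [h_get]
    split_ifs <;> rfl
  · rw [not_lt, max_le_iff] at hw
    have h_length : (updateInput l v q).length ≤ w := by simpa [updateInput] using hw
    rw [if_neg (Nat.lt_of_succ_le hw.2).ne', List.getD_eq_default _ _ h_length, inputOf,
      List.getD_eq_default _ _ hw.1]

theorem primrec_updateInput :
    Primrec fun x : List FracLit × Var × FracLit => updateInput x.1 x.2.1 x.2.2 := by
  refine Primrec.list_map (Primrec.list_range.comp (Primrec.nat_max.comp
    (Primrec.list_length.comp .fst) (Primrec.succ.comp (.comp .fst .snd)))) ?_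
  exact .ite (Primrec.eq.comp .snd (.comp .fst (.comp .snd .fst))) (.comp .snd (.comp .snd .fst))
    ((Primrec.list_getD _).comp (.comp .fst .fst) .snd)

/-- The probability denoted by a literal as a signed fraction, whose denominator is stored
decremented. -/
def ProbLit.toSFrac (p : ProbLit) : SFrac := (p.left, 0, p.left + p.right - 1)

theorem ProbLit.value_toSFrac (p : ProbLit) : p.toSFrac.value = p.value := by
  have h_den : ((p.left + p.right - 1 : ℕ) : ℚ) + 1 = p.left + p.right := by
    rw [← Nat.cast_add_one, Nat.sub_add_cancel p.pos, Nat.cast_add]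
  simp [toSFrac, SFrac.value, value, h_den]

theorem ProbLit.primrec_toSFrac : Primrec ProbLit.toSFrac := by
  have h_odds : Primrec fun p : ProbLit => Nat.unpair (Encodable.encode p + 1) :=
    Primrec.unpair.comp (Primrec.succ.comp .encode)
  refine (Primrec.pair (.comp .fst h_odds) (.pair (.const 0) (Primrec.nat_sub.comp
    (Primrec.nat_add.comp (.comp .fst h_odds) (.comp .snd h_odds)) (.const 1)))).of_eq fun p => ?_
  have h_decode : Nat.unpair (Encodable.encode p + 1) = (p.left, p.right) :=
    have h := ProbLit.equivNat.symm_apply_apply p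
    Prod.ext (congrArg ProbLit.left h) (congrArg ProbLit.right h)
  simp only [h_decode, toSFrac]

/-- Weighted configurations of the stack machine: stack, valuation and weight. -/
abbrev Config : Type := List Prog × List FracLit × SFrac

/-- The successors of a configuration; a probabilistic choice distributes the weight. -/
def stepConfig : Config → List Config
  | ([], l, w) => [([], l, w)]
  | (.assign v e :: s, l, w) => [(s, updateInput l v (e.evalFrac l).toFracLit, w)]
  | (.seq P Q :: s, l, w) => [(P :: Q :: s, l, w)]
  | (.choice p P Q :: s, l, w) =>
    [(P :: s, l, w.mul p.toSFrac), (Q :: s, l, w.mul (.sub (1, 0, 0) p.toSFrac))]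
  | (.while b P :: s, l, w) =>
    if b.eval (inputOf l) then [(P :: .while b P :: s, l, w)] else [(s, l, w)]

section PrimrecStep

variable {α : Type*} [Primcodable α] {s : α → List Prog} {l : α → List FracLit} {w : α → SFrac}

theorem primrec_list_singleton {β : Type*} [Primcodable β] {f : α → β} (hf : Primrec f) :
    Primrec fun a => [f a] :=
  Primrec.list_cons.comp hf (.const [])

theorem primrec_stepConfig_assign (hs : Primrec s) (hl : Primrec l) (hw : Primrec w) :
    Primrec fun x : α × Var × AExp => stepConfig (.assign x.2.1 x.2.2 :: s x.1, l x.1, w x.1) :=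
  primrec_list_singleton (.pair (hs.comp .fst) (.pair
    (primrec_updateInput.comp (.pair (hl.comp .fst) (.pair (.comp .fst .snd)
      (SFrac.primrec_toFracLit.comp
        (AExp.primrec_evalFrac.comp (hl.comp .fst) (.comp .snd .snd))))))
    (hw.comp .fst)))

theorem primrec_stepConfig_seq (hs : Primrec s) (hl : Primrec l) (hw : Primrec w) :
    Primrec fun x : α × Prog × Prog => stepConfig (.seq x.2.1 x.2.2 :: s x.1, l x.1, w x.1) :=
  primrec_list_singleton (.pair (Primrec.list_cons.comp (.comp .fst .snd)
    (Primrec.list_cons.comp (.comp .snd .snd) (hs.comp .fst))) (.comp (.pair hl hw) .fst))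

theorem primrec_stepConfig_choice (hs : Primrec s) (hl : Primrec l) (hw : Primrec w) :
    Primrec fun x : α × ProbLit × Prog × Prog =>
      stepConfig (.choice x.2.1 x.2.2.1 x.2.2.2 :: s x.1, l x.1, w x.1) := by
  have h_prob : Primrec fun x : α × ProbLit × Prog × Prog => x.2.1.toSFrac :=
    ProbLit.primrec_toSFrac.comp (.comp .fst .snd)
  exact Primrec.list_cons.comp
    (.pair (Primrec.list_cons.comp (.comp .fst (.comp .snd .snd)) (hs.comp .fst))
      (.pair (hl.comp .fst) (SFrac.primrec_mul.comp (hw.comp .fst) h_prob)))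
    (primrec_list_singleton
      (.pair (Primrec.list_cons.comp (.comp .snd (.comp .snd .snd)) (hs.comp .fst))
        (.pair (hl.comp .fst)
          (SFrac.primrec_mul.comp (hw.comp .fst) (SFrac.primrec_sub.comp (.const _) h_prob)))))

theorem Prog.primrec_while : Primrec fun x : BExp × Prog => Prog.while x.1 x.2 :=
  Primrec.encode_iff.1 <| Primrec.nat_add.comp (Primrec.nat_mul.comp (.const 4)
    (Primrec₂.natPair.comp (Primrec.encode.comp .fst) (Primrec.encode.comp .snd))) (.const 3)

theorem primrec_stepConfig_while (hs : Primrec s) (hl : Primrec l) (hw : Primrec w) :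
    Primrec fun x : α × BExp × Prog => stepConfig (.while x.2.1 x.2.2 :: s x.1, l x.1, w x.1) :=
  .ite (Primrec.eq.comp (BExp.primrec_eval.comp (hl.comp .fst) (.comp .fst .snd)) (.const true))
    (primrec_list_singleton (.pair (Primrec.list_cons.comp (.comp .snd .snd)
      (Primrec.list_cons.comp (Prog.primrec_while.comp .snd) (hs.comp .fst)))
      (.comp (.pair hl hw) .fst)))
    (primrec_list_singleton (.pair (hs.comp .fst) (.comp (.pair hl hw) .fst)))

end PrimrecStep

theorem primrec_stepConfig : Primrec stepConfig := by
  have hs : Primrec fun x : Config × Prog × List Prog => x.2.2 := .comp .snd .snd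
  have hl : Primrec fun x : Config × Prog × List Prog => x.1.2.1 := .comp .fst (.comp .snd .fst)
  have hw : Primrec fun x : Config × Prog × List Prog => x.1.2.2 := .comp .snd (.comp .snd .fst)
  have h_cons := Prog.primrec_casesOn (f := fun x : Config × Prog × List Prog => x.2.1)
    (.comp .fst .snd) (primrec_stepConfig_assign hs hl hw).to₂
    (primrec_stepConfig_seq hs hl hw).to₂ (primrec_stepConfig_choice hs hl hw).to₂
    (primrec_stepConfig_while hs hl hw).to₂
  refine (Primrec.list_casesOn .fst (primrec_list_singleton .id) h_cons.to₂).of_eq ?_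
  rintro ⟨_ | ⟨_ | _ | _ | _, s⟩, l, w⟩ <;> rfl

/-- The total weight of the halted configurations in a list. -/
def haltedWeight (L : List Config) : SFrac :=
  L.foldr (fun c t => if c.1 = [] then c.2.2.add t else t) (0, 0, 0)

theorem primrec_haltedWeight : Primrec haltedWeight := by
  refine Primrec.list_foldr (h := fun _ (x : Config × SFrac) =>
    if x.1.1 = [] then x.1.2.2.add x.2 else x.2) .id (.const (0, 0, 0)) ?_
  exact .ite (Primrec.eq.comp (.comp .fst (.comp .fst .snd)) (.const []))
    (SFrac.primrec_add.comp (.comp .snd (.comp .snd (.comp .fst .snd))) (.comp .snd .snd))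
    (.comp .snd .snd)

/-- The weight that halts within `n` steps when the configuration `c` is run. -/
def Config.haltWeight (n : ℕ) (c : Config) : ℚ := c.2.2.value * stackHalt n c.1 (inputOf c.2.1)

theorem sum_haltWeight_stepConfig (n : ℕ) (c : Config) :
    ((stepConfig c).map (Config.haltWeight n)).sum = c.haltWeight (n + 1) := by
  obtain ⟨s, l, w⟩ := c
  rcases s with _ | ⟨⟨v, e⟩ | ⟨P, Q⟩ | ⟨p, P, Q⟩ | ⟨b, P⟩, s⟩
  · simp [stepConfig, Config.haltWeight]
  · simp [stepConfig, Config.haltWeight, stackHalt, inputOf_updateInput, SFrac.value_toFracLit,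
      AExp.value_evalFrac]
  · simp [stepConfig, Config.haltWeight, stackHalt]
  · have h_one : SFrac.value (1, 0, 0) = 1 := by simp [SFrac.value]
    simp only [stepConfig, List.map_cons, List.map_nil, List.sum_cons, List.sum_nil,
      Config.haltWeight, stackHalt, SFrac.value_mul, SFrac.value_sub, ProbLit.value_toSFrac, h_one,
      NNRat.cast_add, NNRat.cast_mul, NNRat.coe_sub p.value_le_one, NNRat.cast_one]
    ring
  · by_cases hb : b.eval (inputOf l) = true <;>
      simp [stepConfig, Config.haltWeight, stackHalt, hb]

theorem value_haltedWeight (L : List Config) :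
    (haltedWeight L).value = (L.map (Config.haltWeight 0)).sum := by
  induction L with
  | nil => simp [haltedWeight, SFrac.value]
  | cons c L ih =>
    rw [List.map_cons, List.sum_cons, ← ih]
    obtain ⟨_ | ⟨P, s⟩, l, w⟩ := c <;>
      simp [haltedWeight, Config.haltWeight, stackHalt, SFrac.value_add]

theorem value_haltedWeight_iterate (n : ℕ) (L : List Config) :
    (haltedWeight ((·.flatMap stepConfig)^[n] L)).value = (L.map (Config.haltWeight n)).sum := by
  induction n generalizing L with
  | zero => exact value_haltedWeight L
  | succ n ih =>
    rw [Function.iterate_succ_apply, ih, List.map_flatMap, List.flatMap_def,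
      List.sum_flatten, List.map_map]
    simp only [Function.comp_def, sum_haltWeight_stepConfig]

/-- The probability of halting within `n` steps, as a signed fraction. -/
def haltFrac (x : Prog × List FracLit) (n : ℕ) : SFrac :=
  haltedWeight ((·.flatMap stepConfig)^[n] [([x.1], x.2, (1, 0, 0))])

theorem value_haltFrac (x : Prog × List FracLit) (n : ℕ) :
    (haltFrac x n).value = stackHalt n [x.1] (inputOf x.2) := by
  rw [haltFrac, value_haltedWeight_iterate]
  simp [Config.haltWeight, SFrac.value]

theorem primrec_haltFrac : Primrec₂ haltFrac := by
  refine primrec_haltedWeight.comp (Primrec.nat_iterate (h := fun _ L => L.flatMap stepConfig)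
    .snd (primrec_list_singleton ?_) ?_)
  · exact .pair (primrec_list_singleton (.comp .fst .fst)) (.pair (.comp .snd .fst) (.const _))
  · exact Primrec.list_flatMap .snd (primrec_stepConfig.comp .snd)

/-! ### Membership in `Π⁰₂` -/

theorem AST_iff (x : Prog × List FracLit) :
    AST x ↔ ∀ j : ℕ, ∃ n, SFrac.value (1, 0, 0) < (SFrac.add (haltFrac x n) (1, 0, j)).value := by
  have h_iff (j n : ℕ) : SFrac.value (1, 0, 0) < (SFrac.add (haltFrac x n) (1, 0, j)).value ↔
      1 < stackHalt n [x.1] (inputOf x.2) + 1 / (j + 1 : ℚ≥0) := by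
    rw [SFrac.value_add, value_haltFrac, ← NNRat.coe_lt_coe]
    simp [SFrac.value]
  simp only [h_iff, AST, terminatesAS_iff]
  refine ⟨fun h j => h _ (by positivity), fun h ε hε => ?_⟩
  obtain ⟨j, hj⟩ := exists_nat_one_div_lt hε
  exact (h j).imp fun n hn => hn.trans (add_lt_add_right hj _)

theorem isPi02_AST : IsPi02 AST :=
  ⟨_, PrimrecPred.computablePred <| SFrac.primrecRel_value_lt.comp (.const (1, 0, 0)) <|
    SFrac.primrec_add.comp (primrec_haltFrac.comp .fst (.comp .snd .snd))
      (.pair (.const 1) (.pair (.const 0) (.comp .fst .snd))), AST_iff⟩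

theorem IsPi02.forall {α γ : Type} [Primcodable α] [Denumerable γ] {A : α × γ → Prop}
    (hA : IsPi02 A) : IsPi02 fun a => ∀ c, A (a, c) := by
  obtain ⟨R, hR, h⟩ := hA
  let f (x : α × ℕ × ℕ) : (α × γ) × ℕ × ℕ :=
    ((x.1, Denumerable.ofNat γ (Nat.unpair x.2.1).1), (Nat.unpair x.2.1).2, x.2.2)
  have hf : Primrec f := by
    have h_unpair : Primrec fun x : α × ℕ × ℕ => Nat.unpair x.2.1 :=
      Primrec.unpair.comp (.comp .fst .snd)
    exact .pair (.pair .fst ((Primrec.ofNat γ).comp (.comp .fst h_unpair)))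
      (.pair (.comp .snd h_unpair) (.comp .snd .snd))
  refine ⟨fun x => R (f x),
    ComputablePred.computable_of_manyOneReducible ⟨f, hf.to_comp, fun _ => Iff.rfl⟩ hR, fun a => ?_⟩
  simp only [h]
  refine ⟨fun H y => H (Denumerable.ofNat γ (Nat.unpair y).1) (Nat.unpair y).2, fun H c y => ?_⟩
  simpa [f] using H (Nat.pair (Encodable.encode c) y)

/-- A strict upper bound on the variables in an arithmetical expression. -/
def AExp.bound : AExp → ℕ
  | .lit _ => 0
  | .var v => v + 1
  | .add e₁ e₂ | .sub e₁ e₂ | .mul e₁ e₂ => max e₁.bound e₂.bound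

/-- A strict upper bound on the variables in a Boolean expression. -/
def BExp.bound : BExp → ℕ
  | .eq e₁ e₂ | .lt e₁ e₂ => max e₁.bound e₂.bound
  | .not b => b.bound
  | .and b₁ b₂ => max b₁.bound b₂.bound

/-- A strict upper bound on the variables read by a program. -/
def Prog.bound : Prog → ℕ
  | .assign _ e => e.bound
  | .seq P Q | .choice _ P Q => max P.bound Q.bound
  | .while b P => max b.bound P.bound

section Bound

variable {η η' : Val} {N : ℕ}

theorem AExp.eval_congr (h : ∀ v < N, η v = η' v) (e : AExp) (he : e.bound ≤ N) :
    e.eval η = e.eval η' := by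
  induction e <;> simp_all [bound, eval]

theorem BExp.eval_congr (h : ∀ v < N, η v = η' v) (b : BExp) (hb : b.bound ≤ N) :
    b.eval η = b.eval η' := by
  induction b with
  | eq a b | lt a b =>
    simp only [bound, max_le_iff] at hb
    rw [eval, eval, a.eval_congr h hb.1, b.eval_congr h hb.2]
  | not b ih => rw [eval, eval, ih hb]
  | and a b iha ihb =>
    simp only [bound, max_le_iff] at hb
    rw [eval, eval, iha hb.1, ihb hb.2]

theorem stackHalt_congr (n : ℕ) (s : List Prog) (hs : ∀ P ∈ s, P.bound ≤ N)
    (h : ∀ v < N, η v = η' v) : stackHalt n s η = stackHalt n s η' := by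
  induction n generalizing s η η' with
  | zero => cases s <;> rfl
  | succ n ih =>
    rcases s with _ | ⟨⟨v, e⟩ | ⟨P, Q⟩ | ⟨p, P, Q⟩ | ⟨b, P⟩, s⟩
    · simp
    all_goals simp only [List.forall_mem_cons, Prog.bound, max_le_iff] at hs
    · rw [stackHalt, stackHalt, e.eval_congr h hs.1]
      refine ih s hs.2 fun w hw => ?_
      rw [Function.update_apply, Function.update_apply, h w hw]
    · rw [stackHalt, stackHalt]
      exact ih _ (by simpa [and_assoc] using hs) h
    · rw [stackHalt, stackHalt, ih (P :: s) (by simpa using ⟨hs.1.1, hs.2⟩) h,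
        ih (Q :: s) (by simpa using ⟨hs.1.2, hs.2⟩) h]
    · rw [stackHalt, stackHalt, b.eval_congr h hs.1.1, ih s hs.2 h,
        ih (P :: .while b P :: s) (by simpa [Prog.bound] using ⟨hs.1.2, hs.1, hs.2⟩) h]

end Bound

theorem terminatesAS_congr {P : Prog} {η η' : Val} (h : ∀ v < P.bound, η v = η' v) :
    TerminatesAS P η ↔ TerminatesAS P η' := by
  simp only [terminatesAS_iff, stackHalt_congr _ [P] (by simp) h]

theorem exists_inputOf_eq (N : ℕ) (η : Val) : ∃ l, ∀ v < N, η v = inputOf l v := by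
  choose lit h_lit using fun v => FracLit.exists_value_eq (η v)
  exact ⟨(List.range N).map lit, fun v hv => by simp [inputOf, List.getD, hv, h_lit]⟩

theorem UAST_iff (P : Prog) : UAST P ↔ ∀ l, AST (P, l) := by
  refine ⟨fun h l => h _, fun h η => ?_⟩
  obtain ⟨l, hl⟩ := exists_inputOf_eq P.bound η
  exact (terminatesAS_congr hl).2 (h l)

theorem isPi02_UAST : IsPi02 UAST := by
  rw [funext fun P => propext (UAST_iff P)]
  exact isPi02_AST.forall

/-! ### Deterministic executions -/

/-- `P` runs from `η` to `η'` without probabilistic branching. -/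
def Exec (P : Prog) (η η' : Val) : Prop :=
  ∃ j, ∀ n s, stackHalt (n + j) (P :: s) η = stackHalt n s η'

theorem Exec.assign {η : Val} {e : AExp} {m : ℕ} (h : e.eval η = m) (v : Var) :
    Exec (.assign v e) η (Function.update η v (m : ℚ≥0)) :=
  ⟨1, fun n s => by rw [stackHalt, h, NNRat.toNNRat_coe_nat]⟩

theorem Exec.seq {P Q : Prog} {η η₁ η₂ : Val} (hP : Exec P η η₁) (hQ : Exec Q η₁ η₂) :
    Exec (.seq P Q) η η₂ := by
  obtain ⟨j, hj⟩ := hP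
  obtain ⟨k, hk⟩ := hQ
  exact ⟨k + j + 1, fun n s => by rw [← add_assoc, stackHalt, ← add_assoc, hj, hk]⟩

theorem Exec.while_false {b : BExp} {η : Val} (h : b.eval η = false) (P : Prog) :
    Exec (.while b P) η η :=
  ⟨1, fun n s => by simp [stackHalt, h]⟩

theorem Exec.while_true {b : BExp} {P : Prog} {η η₁ η₂ : Val} (h : b.eval η = true)
    (hP : Exec P η η₁) (hw : Exec (.while b P) η₁ η₂) : Exec (.while b P) η η₂ := by
  obtain ⟨j, hj⟩ := hP
  obtain ⟨k, hk⟩ := hw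
  exact ⟨k + j + 1, fun n s => by rw [← add_assoc, stackHalt, if_pos h, ← add_assoc, hj, hk]⟩

theorem exists_exec_while_of_invariant {b : BExp} {P : Prog} {I : ℕ → Val → Prop} {N : ℕ}
    (h_guard : ∀ y < N, ∀ η, I y η → b.eval η = true)
    (h_body : ∀ y < N, ∀ η, I y η → ∃ η', Exec P η η' ∧ I (y + 1) η')
    (h_exit : ∀ η, I N η → b.eval η = false) {η : Val} (h_init : I 0 η) :
    ∃ η', Exec (.while b P) η η' ∧ I N η' := by
  suffices h : ∀ y ≤ N, ∀ η, I y η → ∃ η', Exec (.while b P) η η' ∧ I N η' from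
    h 0 N.zero_le η h_init
  intro y hy
  induction hy using Nat.decreasingInduction with
  | self => exact fun η hη => ⟨η, .while_false (h_exit η hη) P, hη⟩
  | of_succ y hy ih =>
    intro η hη
    obtain ⟨η₁, h_exec, hη₁⟩ := h_body y hy η hη
    obtain ⟨η', h_loop, hη'⟩ := ih η₁ hη₁
    exact ⟨η', .while_true (h_guard y hy η hη) h_exec h_loop, hη'⟩

theorem Exec.exists_stackHalt_eq_one {P : Prog} {η η' : Val} (h : Exec P η η') :
    ∃ n, stackHalt n [P] η = 1 := by
  obtain ⟨j, hj⟩ := h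
  exact ⟨0 + j, by rw [hj, stackHalt_nil]⟩

theorem Exec.stackHalt_cons_le {P : Prog} {η η' : Val} (h : Exec P η η') (n : ℕ)
    (s : List Prog) : stackHalt n (P :: s) η ≤ stackHalt n s η' := by
  obtain ⟨j, hj⟩ := h
  rw [← hj]
  exact stackHalt_mono (Nat.le_add_right n j) _ _

theorem stackHalt_while_eq_zero {b : BExp} {P : Prog} {I : Val → Prop}
    (h_guard : ∀ η, I η → b.eval η = true) (h_body : ∀ η, I η → ∃ η', Exec P η η' ∧ I η') (n : ℕ)
    (s : List Prog) {η : Val} (hη : I η) : stackHalt n (.while b P :: s) η = 0 := by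
  induction n generalizing η with
  | zero => rfl
  | succ n ih =>
    obtain ⟨η', h_exec, hη'⟩ := h_body η hη
    rw [stackHalt, if_pos (h_guard η hη), ← nonpos_iff_eq_zero, ← ih hη']
    exact h_exec.stackHalt_cons_le _ _

/-- The numeral `m`. -/
def AExp.numeral (m : ℕ) : AExp := .lit (m, 0)

@[simp] theorem AExp.eval_numeral (η : Val) (m : ℕ) : (AExp.numeral m).eval η = m := by
  simp [numeral, eval, FracLit.value]

/-- The program `v := v + 1`. -/
def Prog.incr (v : Var) : Prog := .assign v (.add (.var v) (.numeral 1))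

theorem Exec.incr {η : Val} {v : Var} {m : ℕ} (h : η v = m) :
    Exec (.incr v) η (Function.update η v ((m + 1 : ℕ) : ℚ≥0)) :=
  .assign (by simp [AExp.eval, h]) v

theorem Exec.assign_numeral (η : Val) (v : Var) (m : ℕ) :
    Exec (.assign v (.numeral m)) η (Function.update η v (m : ℚ≥0)) :=
  .assign (AExp.eval_numeral η m) v

/-! ### Primitive recursive functions as programs -/

/-- `P` computes `f` from the registers `a` into the register `b`, leaving the registers below `b`
unchanged. Registers above `b` serve as scratch space. -/
def Computes {n : ℕ} (P : Prog) (f : List.Vector ℕ n → ℕ) (a : Fin n → Var) (b : Var) : Prop :=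
  ∀ (η : Val) (u : List.Vector ℕ n), (∀ i, η (a i) = u.get i) →
    ∃ η', Exec P η η' ∧ η' b = f u ∧ ∀ v < b, η' v = η v

/-- `f` is computed by programs, for every choice of argument registers below a result register. -/
def ProgComputable {n : ℕ} (f : List.Vector ℕ n → ℕ) : Prop :=
  ∀ (a : Fin n → Var) (b : Var), (∀ i, a i < b) → ∃ P, Computes P f a b

theorem computes_assign {n : ℕ} {f : List.Vector ℕ n → ℕ} {e : AExp} {a : Fin n → Var}
    (h : ∀ (η : Val) (u : List.Vector ℕ n), (∀ i, η (a i) = u.get i) → e.eval η = f u) (b : Var) :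
    Computes (.assign b e) f a b := fun η u hu =>
  ⟨_, .assign (h η u hu) b, Function.update_self .., fun _ hv => Function.update_of_ne hv.ne _ _⟩

theorem exists_exec_family {m n : ℕ} {g : Fin n → List.Vector ℕ m → ℕ}
    (hg : ∀ i, ProgComputable (g i)) {a : Fin m → Var} {b : Var} (ha : ∀ i, a i < b) (k : ℕ)
    (hk : k ≤ n) : ∃ P, ∀ (η : Val) (u : List.Vector ℕ m), (∀ i, η (a i) = u.get i) →
      ∃ η', Exec P η η' ∧ (∀ i : Fin n, i < k → η' (b + i) = g i u) ∧ ∀ v < b, η' v = η v := by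
  induction k with
  | zero =>
    refine ⟨.assign b (.numeral 0), fun η u _ => ⟨_, .assign_numeral η b 0, ?_, fun v hv => ?_⟩⟩
    · exact fun i hi => absurd hi (Nat.not_lt_zero _)
    · exact Function.update_of_ne hv.ne _ _
  | succ k ih =>
    obtain ⟨P, hP⟩ := ih (Nat.le_of_succ_le hk)
    obtain ⟨Q, hQ⟩ := hg ⟨k, hk⟩ a (b + k) fun i => Nat.lt_add_right k (ha i)
    refine ⟨.seq P Q, fun η u hu => ?_⟩
    obtain ⟨η₁, h_exec₁, h_val₁, h_low₁⟩ := hP η u hu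
    obtain ⟨η₂, h_exec₂, h_val₂, h_low₂⟩ := hQ η₁ u fun i => by rw [h_low₁ _ (ha i), hu]
    refine ⟨η₂, h_exec₁.seq h_exec₂, fun i hi => ?_, fun v hv => ?_⟩
    · rcases Nat.lt_succ_iff_lt_or_eq.1 hi with hi | hi
      · rw [h_low₂ _ (Nat.add_lt_add_left hi b), h_val₁ i hi]
      · obtain rfl : i = ⟨k, hk⟩ := Fin.ext hi
        exact h_val₂
    · rw [h_low₂ v (Nat.lt_add_right k hv), h_low₁ v hv]

theorem ProgComputable.comp {m n : ℕ} {f : List.Vector ℕ n → ℕ} {g : Fin n → List.Vector ℕ m → ℕ}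
    (hf : ProgComputable f) (hg : ∀ i, ProgComputable (g i)) :
    ProgComputable fun u => f (List.Vector.ofFn fun i => g i u) := by
  intro a b ha
  obtain ⟨P, hP⟩ := exists_exec_family hg ha n le_rfl
  obtain ⟨Q, hQ⟩ := hf (fun i => b + i) (b + n) fun i => Nat.add_lt_add_left i.2 b
  refine ⟨.seq P (.seq Q (.assign b (.var (b + n)))), fun η u hu => ?_⟩
  obtain ⟨η₁, h_exec₁, h_val₁, h_low₁⟩ := hP η u hu
  obtain ⟨η₂, h_exec₂, h_val₂, h_low₂⟩ := hQ η₁ (List.Vector.ofFn fun i => g i u) fun i => by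
    rw [h_val₁ i i.2, List.Vector.get_ofFn]
  refine ⟨_, h_exec₁.seq (h_exec₂.seq (.assign (e := .var (b + n)) ?_ b)),
    Function.update_self .., fun v hv => ?_⟩
  · rw [AExp.eval, h_val₂, NNRat.cast_natCast]
  · rw [Function.update_of_ne hv.ne, h_low₂ v (Nat.lt_add_right n hv), h_low₁ v hv]

/-- The loop of a primitive recursion: the register `b + 1` counts up to the value of the register
`c`, the register `b` holds the current value, and `Q` puts the next value into `b + 2`. -/
def precLoop (Q : Prog) (c b : Var) : Prog :=
  .while (.lt (.var (b + 1)) (.var c)) (.seq Q (.seq (.assign b (.var (b + 2))) (.incr (b + 1))))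

/-- The registers holding the counter, the current value and the parameters of the recursion run by
`precLoop`, whose own argument registers are `a`. -/
def precArgs {n : ℕ} (a : Fin (n + 1) → Var) (b : Var) : Fin (n + 2) → Var :=
  Fin.cons (b + 1) (Fin.cons b (Fin.tail a))

theorem precArgs_lt {n : ℕ} {a : Fin (n + 1) → Var} {b : Var} (ha : ∀ i, a i < b)
    (i : Fin (n + 2)) : precArgs a b i < b + 2 := by
  refine Fin.cases ?_ (fun i => Fin.cases ?_ (fun i => ?_) i) i
  · simp [precArgs]
  · simp [precArgs]
  · exact Nat.lt_add_right 2 (ha i.succ)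

theorem exists_exec_precLoop {n : ℕ} {g : List.Vector ℕ (n + 2) → ℕ} {Q : Prog}
    {a : Fin (n + 1) → Var} {b : Var} (ha : ∀ i, a i < b) (hQ : Computes Q g (precArgs a b) (b + 2))
    {u : List.Vector ℕ (n + 1)} {r : ℕ → ℕ} (hr : ∀ y, r (y + 1) = g (y ::ᵥ r y ::ᵥ u.tail))
    {η : Val} (hu : ∀ i, η (a i) = u.get i) (h_count : η (b + 1) = 0) (h_val : η b = r 0) :
    ∃ η', Exec (precLoop Q (a 0) b) η η' ∧ η' b = r u.head ∧ ∀ v < b, η' v = η v := by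
  let I (y : ℕ) (ζ : Val) : Prop := ζ (b + 1) = y ∧ ζ b = r y ∧ ∀ v < b, ζ v = η v
  have h_guard {y : ℕ} {ζ : Val} (hζ : I y ζ) :
      BExp.eval ζ (.lt (.var (b + 1)) (.var (a 0))) = decide (y < u.head) := by
    simp [BExp.eval, AExp.eval, hζ.1, hζ.2.2 _ (ha 0), hu]
  have h_body (y : ℕ) (ζ : Val) : I y ζ → ∃ ζ', Exec
      (.seq Q (.seq (.assign b (.var (b + 2))) (.incr (b + 1)))) ζ ζ' ∧ I (y + 1) ζ' := by
    rintro ⟨h_count, h_val, h_low⟩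
    obtain ⟨ζ₁, h_exec₁, h_val₁, h_low₁⟩ := hQ ζ (y ::ᵥ r y ::ᵥ u.tail) fun i => by
      refine Fin.cases h_count (fun i => Fin.cases h_val (fun i => ?_) i) i
      exact (h_low _ (ha i.succ)).trans (by simp [hu])
    have h_next : AExp.eval ζ₁ (.var (b + 2)) = r (y + 1) := by
      rw [AExp.eval, h_val₁, hr, NNRat.cast_natCast]
    have h_count₁ : Function.update ζ₁ b (r (y + 1) : ℚ≥0) (b + 1) = y := by
      rw [Function.update_of_ne b.succ_ne_self, h_low₁ _ (Nat.lt_succ_self _), h_count]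
    refine ⟨_, h_exec₁.seq ((Exec.assign h_next b).seq (.incr h_count₁)),
      Function.update_self .., by simp, fun v hv => ?_⟩
    rw [Function.update_of_ne (Nat.lt_succ_of_lt hv).ne, Function.update_of_ne hv.ne,
      h_low₁ v (Nat.lt_add_right 2 hv), h_low v hv]
  obtain ⟨η', h_exec, -, h_val', h_low'⟩ := exists_exec_while_of_invariant (I := I) (N := u.head)
    (fun y hy ζ hζ => (h_guard hζ).trans (decide_eq_true hy)) (fun y _ => h_body y)
    (fun ζ hζ => (h_guard hζ).trans (decide_eq_false (lt_irrefl _)))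
    ⟨h_count.trans Nat.cast_zero.symm, h_val, fun _ _ => rfl⟩
  exact ⟨η', h_exec, h_val', h_low'⟩

theorem ProgComputable.prec {n : ℕ} {f : List.Vector ℕ n → ℕ} {g : List.Vector ℕ (n + 2) → ℕ}
    (hf : ProgComputable f) (hg : ProgComputable g) :
    ProgComputable fun u : List.Vector ℕ (n + 1) =>
      u.head.rec (f u.tail) fun y IH => g (y ::ᵥ IH ::ᵥ u.tail) := by
  intro a b ha
  obtain ⟨P, hP⟩ := hf (Fin.tail a) b fun i => ha i.succ
  obtain ⟨Q, hQ⟩ := hg (precArgs a b) (b + 2) (precArgs_lt ha)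
  refine ⟨.seq P (.seq (.assign (b + 1) (.numeral 0)) (precLoop Q (a 0) b)), fun η u hu => ?_⟩
  obtain ⟨η₁, h_exec₁, h_val₁, h_low₁⟩ := hP η u.tail fun i => by
    rw [Fin.tail, hu, List.Vector.get_tail_succ]
  let η₂ := Function.update η₁ (b + 1) ((0 : ℕ) : ℚ≥0)
  have h_low₂ (v : Var) (hv : v < b) : η₂ v = η v :=
    (Function.update_of_ne (Nat.lt_succ_of_lt hv).ne _ _).trans (h_low₁ v hv)
  let r (y : ℕ) : ℕ := y.rec (f u.tail) fun y IH => g (y ::ᵥ IH ::ᵥ u.tail)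
  obtain ⟨η₃, h_exec₃, h_val₃, h_low₃⟩ := exists_exec_precLoop ha hQ (r := r) (fun _ => rfl)
    (η := η₂) (fun i => by rw [h_low₂ _ (ha i), hu]) (by simp [η₂])
    ((Function.update_of_ne b.lt_succ_self.ne _ _).trans h_val₁)
  exact ⟨η₃, h_exec₁.seq ((Exec.assign_numeral η₁ (b + 1) 0).seq h_exec₃), h_val₃,
    fun v hv => (h_low₃ v hv).trans (h_low₂ v hv)⟩

theorem progComputable_of_primrec' {n : ℕ} {f : List.Vector ℕ n → ℕ} (hf : Nat.Primrec' f) :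
    ProgComputable f := by
  induction hf with
  | zero => exact fun a b _ => ⟨_, computes_assign (e := .numeral 0) (fun η _ _ => by simp) b⟩
  | succ =>
    refine fun a b _ => ⟨_, computes_assign (e := .add (.var (a 0)) (.numeral 1)) ?_ b⟩
    intro η u hu
    simp [AExp.eval, hu]
  | get i =>
    refine fun a b _ => ⟨_, computes_assign (e := .var (a i)) ?_ b⟩
    intro η u hu
    simp [AExp.eval, hu]
  | comp g _ _ hf hg => exact hf.comp hg
  | prec _ _ hf hg => exact hf.prec hg

/-! ### Unbounded search -/

/-- The registers `0`, `1`, `2` hold the guess `y`, the instance `x` and the search index `k`. -/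
def Holds (y x k : ℕ) (η : Val) : Prop := η 0 = y ∧ η 1 = x ∧ η 2 = k

theorem Holds.update_zero {y x k : ℕ} {η : Val} (h : Holds y x k η) (m : ℕ) :
    Holds m x k (Function.update η 0 (m : ℚ≥0)) :=
  ⟨by simp, by simp [h.2.1], by simp [h.2.2]⟩

theorem Holds.update_two {y x k : ℕ} {η : Val} (h : Holds y x k η) (m : ℕ) :
    Holds y x m (Function.update η 2 (m : ℚ≥0)) :=
  ⟨by simp [h.1], by simp [h.2.1], by simp⟩

theorem Holds.of_eq_below {y x k : ℕ} {η η' : Val} (h : Holds y x k η)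
    (h_eq : ∀ v < 3, η' v = η v) : Holds y x k η' :=
  ⟨by simp [h_eq, h.1], by simp [h_eq, h.2.1], by simp [h_eq, h.2.2]⟩

/-- Loop incrementing the register `2` until the program `Q` puts `0` into the register `3`. -/
def searchLoop (Q : Prog) : Prog := .while (.lt (.numeral 0) (.var 3)) (.seq Q (.incr 2))

/-- Search, from the current value of the register `2` on, for a value for which `Q` puts `0` into
the register `3`. -/
def search (Q : Prog) : Prog := .seq (.assign 3 (.numeral 1)) (searchLoop Q)

theorem eval_searchLoop_guard (η : Val) :
    BExp.eval η (.lt (.numeral 0) (.var 3)) = decide (0 < η 3) := by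
  simp [BExp.eval, AExp.eval]

section Search

variable {Q : Prog} {G : List.Vector ℕ 3 → ℕ} {y x : ℕ} {η : Val}

theorem exists_exec_search_body (hQ : Computes Q G Fin.val 3) {k : ℕ} (h : Holds y x k η) :
    ∃ η', Exec (.seq Q (.incr 2)) η η' ∧ Holds y x (k + 1) η' ∧
      η' 3 = G (y ::ᵥ x ::ᵥ k ::ᵥ .nil) := by
  obtain ⟨η₁, h_exec, h_val, h_low⟩ := hQ η (y ::ᵥ x ::ᵥ k ::ᵥ .nil) fun i => by
    fin_cases i
    exacts [h.1, h.2.1, h.2.2]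
  have h₁ : Holds y x k η₁ := h.of_eq_below h_low
  exact ⟨_, h_exec.seq (.incr h₁.2.2), h₁.update_two (k + 1), by simp [h_val]⟩

theorem exists_exec_searchLoop (hQ : Computes Q G Fin.val 3)
    (hG : ∃ k, G (y ::ᵥ x ::ᵥ k ::ᵥ .nil) = 0) (h : Holds y x 0 η) (h_pos : 0 < η 3) :
    ∃ η', Exec (searchLoop Q) η η' := by
  let K := Nat.find hG
  let I (k : ℕ) (ζ : Val) : Prop := Holds y x k ζ ∧ (0 < ζ 3 ↔ k ≤ K)
  have h_guard {k : ℕ} {ζ : Val} (hζ : I k ζ) :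
      BExp.eval ζ (.lt (.numeral 0) (.var 3)) = decide (k ≤ K) := by
    rw [eval_searchLoop_guard, decide_eq_decide, hζ.2]
  have h_body (k : ℕ) (hk : k < K + 1) (ζ : Val) (hζ : I k ζ) :
      ∃ ζ', Exec (.seq Q (.incr 2)) ζ ζ' ∧ I (k + 1) ζ' := by
    obtain ⟨ζ', h_exec, h', h_val⟩ := exists_exec_search_body hQ hζ.1
    refine ⟨ζ', h_exec, h', ?_⟩
    rw [h_val, Nat.cast_pos, Nat.pos_iff_ne_zero]
    refine ⟨fun h_ne => ?_, fun hk => Nat.find_min hG hk⟩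
    by_contra h_not_le
    obtain rfl : k = K := by omega
    exact h_ne (Nat.find_spec hG)
  obtain ⟨η', h_exec, -⟩ := exists_exec_while_of_invariant (I := I) (N := K + 1)
    (fun k hk ζ hζ => (h_guard hζ).trans (decide_eq_true (Nat.le_of_lt_succ hk))) h_body
    (fun ζ hζ => (h_guard hζ).trans (decide_eq_false K.not_succ_le_self)) ⟨h, by simp [h_pos]⟩
  exact ⟨η', h_exec⟩

theorem exists_stackHalt_search_eq_one (hQ : Computes Q G Fin.val 3)
    (hG : ∃ k, G (y ::ᵥ x ::ᵥ k ::ᵥ .nil) = 0) (h : Holds y x 0 η) :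
    ∃ n, stackHalt n [search Q] η = 1 := by
  obtain ⟨η', h_exec⟩ := exists_exec_searchLoop hQ hG (η := Function.update η 3 ((1 : ℕ) : ℚ≥0))
    (h.of_eq_below fun v hv => Function.update_of_ne hv.ne _ _) (by simp)
  exact ((Exec.assign_numeral η 3 1).seq h_exec).exists_stackHalt_eq_one

theorem stackHalt_search_eq_zero (hQ : Computes Q G Fin.val 3)
    (hG : ∀ k, G (y ::ᵥ x ::ᵥ k ::ᵥ .nil) ≠ 0) (h : Holds y x 0 η) (n : ℕ) :
    stackHalt n [search Q] η = 0 := by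
  have h_loop (ζ : Val) (hζ : (∃ k, Holds y x k ζ) ∧ 0 < ζ 3) :
      stackHalt n [searchLoop Q] ζ = 0 := by
    refine stackHalt_while_eq_zero (I := fun ζ => (∃ k, Holds y x k ζ) ∧ 0 < ζ 3) ?_ ?_ n [] hζ
    · exact fun ζ hζ => (eval_searchLoop_guard ζ).trans (decide_eq_true hζ.2)
    · rintro ζ ⟨⟨k, hk⟩, -⟩
      obtain ⟨ζ', h_exec, h', h_val⟩ := exists_exec_search_body hQ hk
      exact ⟨ζ', h_exec, ⟨_, h'⟩, by simpa [h_val] using Nat.pos_of_ne_zero (hG k)⟩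
  rw [← nonpos_iff_eq_zero]
  calc stackHalt n [search Q] η
      ≤ stackHalt n [.assign 3 (.numeral 1), searchLoop Q] η := stackHalt_le_succ _ _ _
    _ ≤ stackHalt n [searchLoop Q] (Function.update η 3 ((1 : ℕ) : ℚ≥0)) :=
        (Exec.assign_numeral η 3 1).stackHalt_cons_le _ _
    _ = 0 := h_loop _
        ⟨⟨0, h.of_eq_below fun v hv => Function.update_of_ne hv.ne _ _⟩, by simp⟩

end Search

/-! ### Random choice of a natural number -/

/-- The odds of a fair coin. -/
def fairCoin : ProbLit := ⟨1, 1, by norm_num⟩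

theorem value_fairCoin : fairCoin.value = 1 / 2 := by
  norm_num [fairCoin, ProbLit.value]

/-- Toss a fair coin until the register `2` is cleared, counting the failures in the
register `0`. The register `2` serves as the loop flag here, before it becomes the search index. -/
def geometricLoop : Prog :=
  .while (.eq (.var 2) (.numeral 1)) (.choice fairCoin (.assign 2 (.numeral 0)) (.incr 0))

theorem stackHalt_geometricLoop {y x : ℕ} {η : Val} (h : Holds y x 1 η) :
    ∃ η₀ η₁, Holds y x 0 η₀ ∧ Holds (y + 1) x 1 η₁ ∧ ∀ n s,
      stackHalt (n + 4) (geometricLoop :: s) η =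
        1 / 2 * stackHalt n s η₀ + 1 / 2 * stackHalt (n + 1) (geometricLoop :: s) η₁ := by
  refine ⟨Function.update η 2 ((0 : ℕ) : ℚ≥0), Function.update η 0 ((y + 1 : ℕ) : ℚ≥0),
    h.update_two 0, h.update_zero (y + 1), fun n s => ?_⟩
  have h_guard : BExp.eval η (.eq (.var 2) (.numeral 1)) = true := by
    simp [BExp.eval, AExp.eval, h.2.2]
  have h_exit : ¬ BExp.eval (Function.update η 2 ((0 : ℕ) : ℚ≥0)) (.eq (.var 2) (.numeral 1)) := by
    simp [BExp.eval, AExp.eval]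
  have h_incr : AExp.eval η (.add (.var 0) (.numeral 1)) = ((y + 1 : ℕ) : ℚ) := by
    simp [AExp.eval, h.1]
  have h_half : 1 - (1 / 2 : ℚ≥0) = 1 / 2 := tsub_eq_of_eq_add (by norm_num)
  rw [geometricLoop, stackHalt, if_pos h_guard, stackHalt, value_fairCoin, h_half, Prog.incr,
    stackHalt, stackHalt, AExp.eval_numeral, h_incr, NNRat.toNNRat_coe_nat, NNRat.toNNRat_coe_nat,
    stackHalt, if_neg h_exit]

theorem exists_one_le_stackHalt_geometricLoop {x : ℕ} {s : List Prog}
    (hs : ∀ y η, Holds y x 0 η → ∃ n, stackHalt n s η = 1) (j : ℕ) {y : ℕ} {η : Val}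
    (h : Holds y x 1 η) : ∃ n, 1 ≤ stackHalt n (geometricLoop :: s) η + (1 / 2) ^ j := by
  induction j generalizing y η with
  | zero => exact ⟨0, by simp⟩
  | succ j ih =>
    obtain ⟨η₀, η₁, h₀, h₁, h_step⟩ := stackHalt_geometricLoop h
    obtain ⟨m, hm⟩ := hs y η₀ h₀
    obtain ⟨n, hn⟩ := ih h₁
    have h_exit : 1 ≤ stackHalt (max m n) s η₀ :=
      hm.ge.trans (stackHalt_mono (le_max_left m n) _ _)
    have h_next : 1 ≤ stackHalt (max m n + 1) (geometricLoop :: s) η₁ + (1 / 2) ^ j :=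
      hn.trans (by gcongr; exact stackHalt_mono (Nat.le_succ_of_le (le_max_right m n)) _ _)
    refine ⟨max m n + 4, ?_⟩
    calc (1 : ℚ≥0) = 1 / 2 * 1 + 1 / 2 * 1 := by norm_num
      _ ≤ 1 / 2 * stackHalt (max m n) s η₀ +
          1 / 2 * (stackHalt (max m n + 1) (geometricLoop :: s) η₁ + (1 / 2) ^ j) := by gcongr
      _ = _ := by rw [h_step, pow_succ]; ring

theorem stackHalt_geometricLoop_add_le_one {y d x : ℕ} {s : List Prog}
    (hs : ∀ η, Holds (y + d) x 0 η → ∀ n, stackHalt n s η = 0) {η : Val} (h : Holds y x 1 η)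
    (n : ℕ) : stackHalt n (geometricLoop :: s) η + (1 / 2) ^ (d + 1) ≤ 1 := by
  induction d generalizing y η n with
  | zero =>
    obtain ⟨η₀, η₁, h₀, -, h_step⟩ := stackHalt_geometricLoop h
    calc stackHalt n (geometricLoop :: s) η + (1 / 2) ^ (0 + 1)
        ≤ stackHalt (n + 4) (geometricLoop :: s) η + (1 / 2) ^ (0 + 1) := by
          gcongr
          exact stackHalt_mono (Nat.le_add_right n 4) _ _
      _ ≤ 1 / 2 * 0 + 1 / 2 * 1 + (1 / 2) ^ (0 + 1) := by
          rw [h_step, hs η₀ h₀ n]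
          gcongr
          exact stackHalt_le_one _ _ _
      _ = 1 := by norm_num
  | succ d ih =>
    obtain ⟨η₀, η₁, -, h₁, h_step⟩ := stackHalt_geometricLoop h
    have h_next : stackHalt (n + 1) (geometricLoop :: s) η₁ + (1 / 2) ^ (d + 1) ≤ 1 :=
      ih (fun ζ hζ => hs ζ (by rwa [add_assoc, add_comm 1] at hζ)) h₁ (n + 1)
    calc stackHalt n (geometricLoop :: s) η + (1 / 2) ^ (d + 1 + 1)
        ≤ stackHalt (n + 4) (geometricLoop :: s) η + (1 / 2) ^ (d + 1 + 1) := by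
          gcongr
          exact stackHalt_mono (Nat.le_add_right n 4) _ _
      _ = 1 / 2 * stackHalt n s η₀ + 1 / 2 *
          (stackHalt (n + 1) (geometricLoop :: s) η₁ + (1 / 2) ^ (d + 1)) := by
          rw [h_step]
          ring
      _ ≤ 1 / 2 * 1 + 1 / 2 * 1 := by
          gcongr
          exact stackHalt_le_one _ _ _
      _ = 1 := by norm_num

/-- Put `x` into the register `1` and a random number into the register `0`, then search. -/
def guessAndSearch (Q : Prog) (x : ℕ) : Prog :=
  .seq (.assign 1 (.numeral x)) (.seq (.assign 0 (.numeral 0)) (.seq (.assign 2 (.numeral 1))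
    (.seq geometricLoop (search Q))))

theorem stackHalt_guessAndSearch (Q : Prog) (x : ℕ) (η : Val) : ∃ η₁, Holds 0 x 1 η₁ ∧
    ∀ n, stackHalt (n + 7) [guessAndSearch Q x] η =
      stackHalt n [geometricLoop, search Q] η₁ := by
  refine ⟨Function.update (Function.update (Function.update η 1 (x : ℚ≥0)) 0 ((0 : ℕ) : ℚ≥0)) 2
    ((1 : ℕ) : ℚ≥0), ⟨by simp, by simp, by simp⟩, fun n => ?_⟩
  simp only [guessAndSearch, stackHalt, AExp.eval_numeral, NNRat.toNNRat_coe_nat]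

theorem terminatesAS_guessAndSearch_iff {Q : Prog} {G : List.Vector ℕ 3 → ℕ}
    (hQ : Computes Q G Fin.val 3) (x : ℕ) (η : Val) :
    TerminatesAS (guessAndSearch Q x) η ↔ ∀ y, ∃ k, G (y ::ᵥ x ::ᵥ k ::ᵥ .nil) = 0 := by
  obtain ⟨η₁, hη₁, h_start⟩ := stackHalt_guessAndSearch Q x η
  rw [terminatesAS_iff]
  refine ⟨fun h y => ?_, fun h ε hε => ?_⟩
  · by_contra! hy
    obtain ⟨n, hn⟩ := h ((1 / 2) ^ (y + 1)) (by positivity)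
    refine hn.not_ge ?_
    calc stackHalt n [guessAndSearch Q x] η + (1 / 2) ^ (y + 1)
        ≤ stackHalt (n + 7) [guessAndSearch Q x] η + (1 / 2) ^ (y + 1) := by
          gcongr
          exact stackHalt_mono (Nat.le_add_right n 7) _ _
      _ ≤ 1 := by
          rw [h_start]
          refine stackHalt_geometricLoop_add_le_one (fun ζ hζ => ?_) hη₁ n
          exact stackHalt_search_eq_zero hQ hy (by rwa [zero_add] at hζ)
  · obtain ⟨j, hj⟩ := exists_pow_lt_of_lt_one hε one_half_lt_one
    obtain ⟨n, hn⟩ := exists_one_le_stackHalt_geometricLoop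
      (fun y ζ hζ => exists_stackHalt_search_eq_one hQ (h y) hζ) j hη₁
    refine ⟨n + 7, ?_⟩
    rw [h_start]
    exact hn.trans_lt (add_lt_add_right hj _)

theorem Prog.primrec_assign : Primrec₂ Prog.assign :=
  Primrec₂.encode_iff.1 <| Primrec.nat_mul.comp (.const 4)
    (Primrec₂.natPair.comp .fst (Primrec.encode.comp .snd))

theorem Prog.primrec_seq : Primrec₂ Prog.seq :=
  Primrec₂.encode_iff.1 <| Primrec.succ.comp <| Primrec.nat_mul.comp (.const 4)
    (Primrec₂.natPair.comp (Primrec.encode.comp .fst) (Primrec.encode.comp .snd))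

theorem AExp.primrec_numeral : Primrec AExp.numeral :=
  Primrec.encode_iff.1 <| Primrec.nat_mul.comp (.const 5) (Primrec₂.natPair.comp .id (.const 0))

theorem primrec_guessAndSearch (Q : Prog) : Primrec (guessAndSearch Q) :=
  Prog.primrec_seq.comp (Prog.primrec_assign.comp (.const 1) AExp.primrec_numeral) (.const _)

/-! ### Hardness -/

theorem rePred_exists_nat {α : Type*} [Primcodable α] {R : α × ℕ → Prop} (hR : ComputablePred R) :
    REPred fun a => ∃ z, R (a, z) := by
  obtain ⟨_, hR⟩ := hR
  refine (Partrec.rfind (p := fun a z => decide (R (a, z))) hR.partrec.to₂).dom_re.of_eq fun a =>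
    Nat.rfind_dom.trans (by simp)

open Nat.Partrec (Code)

theorem exists_evaln_isSome_iff {α : Type*} [Primcodable α] {p : α → Prop} (hp : REPred p) :
    ∃ c : Code, ∀ a, p a ↔ ∃ k, (c.evaln k (Encodable.encode a)).isSome := by
  obtain ⟨c, hc⟩ := Code.exists_code.1 hp
  refine ⟨c, fun a => ?_⟩
  have h_dom : p a ↔ (c.eval (Encodable.encode a)).Dom := by
    simp [hc, Part.assert]
  simp only [h_dom, Part.dom_iff_mem, Code.evaln_complete, Option.isSome_iff_exists]
  exact exists_comm

theorem IsPi02.exists_primrec'_iff {β : Type} [Primcodable β] {C : β → Prop} (hC : IsPi02 C) :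
    ∃ G : List.Vector ℕ 3 → ℕ, Nat.Primrec' G ∧
      ∀ x, C x ↔ ∀ y, ∃ k, G (y ::ᵥ Encodable.encode x ::ᵥ k ::ᵥ .nil) = 0 := by
  obtain ⟨R, hR, h⟩ := hC
  have h_assoc : Computable fun w : (β × ℕ) × ℕ => (w.1.1, w.1.2, w.2) :=
    (Primrec.pair (.comp .fst .fst) (.pair (.comp .snd .fst) .snd)).to_comp
  obtain ⟨c, hc⟩ := exists_evaln_isSome_iff <| rePred_exists_nat <|
    ComputablePred.computable_of_manyOneReducible ⟨_, h_assoc, fun _ => Iff.rfl⟩ hR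
  refine ⟨fun v => if (c.evaln (v.get 2) (Nat.pair (v.get 1) (v.get 0))).isSome then 0 else 1,
    Nat.Primrec'.of_prim ?_, fun x => ?_⟩
  · have h_get (i : Fin 3) : Primrec fun v : List.Vector ℕ 3 => v.get i :=
      Primrec.vector_get.comp .id (.const i)
    have h_evaln : Primrec fun v : List.Vector ℕ 3 =>
        c.evaln (v.get 2) (Nat.pair (v.get 1) (v.get 0)) :=
      Code.primrec_evaln.comp
        (.pair (.pair (h_get 2) (.const c)) (Primrec₂.natPair.comp (h_get 1) (h_get 0)))
    exact .ite (Primrec.eq.comp (Primrec.option_isSome.comp h_evaln) (.const true))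
      (.const 0) (.const 1)
  · rw [h]
    refine forall_congr' fun y => (hc (x, y)).trans (exists_congr fun k => ?_)
    change _ ↔ (if (c.evaln k (Nat.pair (Encodable.encode x) y)).isSome then 0 else 1) = 0
    rw [ite_eq_left_iff, imp_iff_not one_ne_zero, not_not]
    rfl

theorem IsPi02.exists_computable_forall_iff_terminatesAS {β : Type} [Primcodable β] {C : β → Prop}
    (hC : IsPi02 C) : ∃ f : β → Prog, Computable f ∧ ∀ x η, C x ↔ TerminatesAS (f x) η := by
  obtain ⟨G, hG, h⟩ := hC.exists_primrec'_iff
  obtain ⟨Q, hQ⟩ := progComputable_of_primrec' hG Fin.val 3 Fin.is_lt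
  refine ⟨fun x => guessAndSearch Q (Encodable.encode x),
    ((primrec_guessAndSearch Q).comp .encode).to_comp, fun x η => ?_⟩
  rw [h, terminatesAS_guessAndSearch_iff hQ]

theorem isPi02Complete_UAST : IsPi02Complete UAST := by
  refine ⟨isPi02_UAST, fun β _ C hC => ?_⟩
  obtain ⟨f, hf, h⟩ := hC.exists_computable_forall_iff_terminatesAS
  exact ⟨f, hf, fun x => ⟨fun hx η => (h x η).1 hx, fun hx => (h x 0).2 (hx 0)⟩⟩

theorem isPi02Complete_AST : IsPi02Complete AST := by
  refine ⟨isPi02_AST, fun β _ C hC => ?_⟩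
  obtain ⟨f, hf, h⟩ := hC.exists_computable_forall_iff_terminatesAS
  exact ⟨fun x => (f x, []), hf.pair (.const []), fun x => h x _⟩

theorem IsPi02Complete.manyOneEquiv {α β : Type} [Primcodable α] [Primcodable β] {A : α → Prop}
    {B : β → Prop} (hA : IsPi02Complete A) (hB : IsPi02Complete B) : ManyOneEquiv A B :=
  ⟨hB.2 _ A hA.1, hA.2 _ B hB.1⟩

end PGCL

theorem mainTheorem2 :
    PGCL.IsPi02Complete PGCL.UAST ∧ ManyOneEquiv PGCL.UAST PGCL.AST :=
  ⟨PGCL.isPi02Complete_UAST, PGCL.isPi02Complete_UAST.manyOneEquiv PGCL.isPi02Complete_AST⟩
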